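/- Let $\mathbb{L}^2=(\mathbb{Z}^2,\mathbb{E})$ be the square lattice (edges join vertices at $\ell^1$-distance $1$). A finite set $\gamma\subset\mathbb{E}$ is a \emph{contour} if the graph $(\mathbb{Z}^2,\mathbb{E}\setminus\gamma)$ has exactly one finite connected component and, for every $e\in\gamma$, the graph $(\mathbb{Z}^2,\mathbb{E}\setminus(\gamma\setminus\{e\}))$ has no finite connected component. The contour $\gamma$ \emph{surrounds} a set $X\subset\mathbb{Z}^2$ if $X$ is contained in the vertex set of the unique finite component of $(\mathbb{Z}^2,\mathbb{E}\setminus\gamma)$, and $\Gamma_X^n$ denotes the set of contours with exactly $n$ edges that surround $X$. For $x=(x_1,x_2)\in\mathbb{Z}^2$ with $x_1,x_2>0$, put $\|x\|=2(x_1+x_2+2)$ and $\beta_x=|\Gamma_{\{0,x\}}^{\|x\|}|$. Then for every integer $m$ with $0\le m\le \|x\|/2$ the sets $\Gamma_{\{0,x\}}^{\|x\|}$ and $\Gamma_{\{0,x\}}^{\|x\|+m}$ are finite and $$\bigl|\Gamma_{\{0,x\}}^{\|x\|+m}\bigr|\le 12^m\binom{\|x\|}{m}\,\beta_x .$$ 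-/

import Mathlib

/-- The square lattice: vertex set `ℤ × ℤ`, with an edge between two vertices
exactly when their `ℓ¹` distance is `1`. -/
def squareLattice : SimpleGraph (ℤ × ℤ) where
  Adj u v := |u.1 - v.1| + |u.2 - v.2| = 1
  symm := ⟨fun u v h => by rw [abs_sub_comm v.1, abs_sub_comm v.2]; exact h⟩
  loopless := ⟨fun u h => by simp at h⟩

/-- The square lattice with the edges of `γ` removed (all vertices are kept). -/
def latticeMinus (γ : Set (Sym2 (ℤ × ℤ))) : SimpleGraph (ℤ × ℤ) :=
  squareLattice.deleteEdges γ

/-- A finite set of edges of the square lattice is a contour if its removal leaves exactly one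
finite connected component, and it is minimal in the sense that putting back any one of its
edges leaves no finite connected component. -/
structure IsContour (γ : Finset (Sym2 (ℤ × ℤ))) : Prop where
  subset_edgeSet : (γ : Set (Sym2 (ℤ × ℤ))) ⊆ squareLattice.edgeSet
  existsUnique_finite : ∃! C : (latticeMinus γ).ConnectedComponent, C.supp.Finite
  minimal : ∀ e ∈ γ, ∀ C : (latticeMinus ((γ : Set (Sym2 (ℤ × ℤ))) \ {e})).ConnectedComponent,
    ¬ C.supp.Finite

/-- The vertex interior of `γ`: the vertices that lie in a finite connected component of the
lattice with `γ` removed. For a contour this is the vertex set of the unique finite component,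
see `IsContour.vertexInterior_eq`. -/
def vertexInterior (γ : Finset (Sym2 (ℤ × ℤ))) : Set (ℤ × ℤ) :=
  {v | ((latticeMinus γ).connectedComponentMk v).supp.Finite}

theorem IsContour.vertexInterior_eq {γ : Finset (Sym2 (ℤ × ℤ))} (hγ : IsContour γ)
    (C : (latticeMinus γ).ConnectedComponent) (hC : C.supp.Finite) :
    vertexInterior γ = C.supp := by
  ext v
  rw [SimpleGraph.ConnectedComponent.mem_supp_iff]
  constructor
  · intro hv
    exact hγ.existsUnique_finite.unique hv hC
  · intro hv
    change ((latticeMinus γ).connectedComponentMk v).supp.Finite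
    rw [hv]
    exact hC

/-- The set of contours with exactly `n` edges that surround the vertex set `X`, i.e. whose
vertex interior contains `X`. -/
def contoursSurrounding (X : Set (ℤ × ℤ)) (n : ℕ) : Set (Finset (Sym2 (ℤ × ℤ))) :=
  {γ | IsContour γ ∧ X ⊆ vertexInterior γ ∧ γ.card = n}

/-- The number `‖x‖ = 2 (x₁ + x₂ + 2)` of edges of a minimal contour surrounding `{0, x}`,
where `x = (x₁, x₂)`. -/
def minimalContourSize (x₁ x₂ : ℕ) : ℕ := 2 * (x₁ + x₂ + 2)

/-- The set of contours with `n` edges surrounding `{0, x}`, where `x = (x₁, x₂)`. -/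
def contoursAround (x₁ x₂ n : ℕ) : Set (Finset (Sym2 (ℤ × ℤ))) :=
  contoursSurrounding {((0 : ℤ), (0 : ℤ)), ((x₁ : ℤ), (x₂ : ℤ))} n

/-- `β_x`: the number of minimal contours surrounding `{0, x}`, that is, of contours with `‖x‖`
edges surrounding `{0, x}`. -/
noncomputable def minimalContourCount (x₁ x₂ : ℕ) : ℕ :=
  (contoursAround x₁ x₂ (minimalContourSize x₁ x₂)).ncard

/-! A contour is the edge boundary of a finite connected set `I` of vertices without holes
(`coe_eq_edgeBoundary`, `IsContour.isRegion`). A simple closed path in the dual lattice runs around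
`I`, and the contour is recovered from the starting point of this path and its word of directions.
The heart of the proof is that this word contains the word of a minimal contour as a subsequence, so
that a contour with m surplus edges arises from a minimal one by inserting m letters.

The minimal contour is the boundary of `hull x I`, the part of the rectangle spanned by 0 and x
between the south-east and north-west staircase envelopes of `I`. The hull is a region that meets
rows and columns in intervals, so its boundary has at most ‖x‖ edges; every boundary path has at
least ‖x‖ steps, because it runs from a south-west corner a ≤ 0 to a north-east corner beyond x and
back (`exists_minimal_contour`).

For the subsequence property (`IsRegion.exists_closed_path`) these two corners cut the cycle into
two arcs. One arc visits the relevant south-east corners of `I` from left to right, the other the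
north-west ones (`IsRegion.exists_arcs`). Between such corners an arc is forced to make the east and
north steps of the envelope (`stairWord_sublist_aux`). The planar topology rests on a signed
crossing number, `upIndex`, which does not change across edges that a closed path does not cross.

There are β_x hulls, the starting point satisfies 2(|a₁| + |a₂|) ≤ m, and at most ∑_{i ≤ m} C(‖x‖ +
m, i) 3^i words contain the prescribed one (`ncard_contoursAround_le`). In `count_le` the constant
appears as 12 = 2 · 3 · 2, from the starting points, the inserted letters, and the passage from
C(‖x‖ + m, m) to C(‖x‖, m). -/

namespace LatticeContour

/-! ### Consecutive pairs of a list -/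

/-- The list of pairs of consecutive entries of a list. -/
def steps {α : Type*} (l : List α) : List (α × α) := l.zip l.tail

section Steps
variable {α : Type*}

@[simp] theorem steps_nil : steps ([] : List α) = [] := rfl
@[simp] theorem steps_singleton (a : α) : steps [a] = [] := rfl
@[simp] theorem steps_cons_cons (a b : α) (l : List α) :
    steps (a :: b :: l) = (a, b) :: steps (b :: l) := rfl

theorem steps_append_cons (l₁ : List α) (a : α) (l₂ : List α) :
    steps (l₁ ++ a :: l₂) = steps (l₁ ++ [a]) ++ steps (a :: l₂) := by
  induction l₁ with
  | nil => simp
  | cons b t ih => cases t <;> simp_all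

theorem fst_mem_of_mem_steps {l : List α} {e : α × α} (h : e ∈ steps l) : e.1 ∈ l :=
  (List.of_mem_zip h).1

theorem snd_mem_of_mem_steps {l : List α} {e : α × α} (h : e ∈ steps l) : e.2 ∈ l :=
  List.mem_of_mem_tail (List.of_mem_zip h).2

theorem length_steps (l : List α) : (steps l).length = l.length - 1 := by
  simp [steps]

theorem steps_reverse (l : List α) : steps l.reverse = ((steps l).map Prod.swap).reverse := by
  induction l with
  | nil => simp
  | cons a t ih =>
    cases t with
    | nil => simp
    | cons b t =>
      have : (a :: b :: t).reverse = t.reverse ++ b :: [a] := by simp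
      rw [this, steps_append_cons]
      have h2 : t.reverse ++ [b] = (b :: t).reverse := by simp
      rw [h2, ih]
      simp

theorem steps_map {β : Type*} (f : α → β) (l : List α) :
    steps (l.map f) = (steps l).map (Prod.map f f) := by
  rw [steps, steps, ← List.map_tail, List.zip_map]

theorem mem_steps_append_left {l₁ l₂ : List α} {e : α × α} (h : e ∈ steps l₁) :
    e ∈ steps (l₁ ++ l₂) := by
  rcases List.eq_nil_or_concat l₁ with rfl | ⟨t, a, rfl⟩
  · simp at h
  · have : t ++ [a] ++ l₂ = t ++ a :: l₂ := by simp
    rw [List.concat_eq_append] at h ⊢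
    rw [this, steps_append_cons]
    exact List.mem_append_left _ h

theorem mem_steps_append_right {l₁ l₂ : List α} {e : α × α} (h : e ∈ steps l₂) :
    e ∈ steps (l₁ ++ l₂) := by
  cases l₂ with
  | nil => simp at h
  | cons a t => rw [steps_append_cons]; exact List.mem_append_right _ h

theorem sum_steps_telescope (g : α → ℤ) (f : α × α → ℤ) {l : List α} {a b : α}
    (ha : l.head? = some a) (hb : l.getLast? = some b)
    (h : ∀ e ∈ steps l, f e = g e.2 - g e.1) : ((steps l).map f).sum = g b - g a := by
  induction l generalizing a with
  | nil => simp at ha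
  | cons c t ih =>
    obtain rfl : c = a := by simpa using ha
    cases t with
    | nil =>
      obtain rfl : c = b := by simpa using hb
      simp
    | cons d t =>
      have := ih (a := d) (by simp) (by simpa using hb) (fun e he => h e (by simp [he]))
      simp only [steps_cons_cons, List.map_cons, List.sum_cons, this,
        h (c, d) (by simp)]
      ring

theorem nodup_steps_mem_head {a b : α} {t : List α} (h : (a :: b :: t).Nodup) {e : α × α}
    (he : e ∈ steps (a :: b :: t)) (h1 : e.1 = a ∨ e.2 = a) : e = (a, b) := by
  simp only [steps_cons_cons, List.mem_cons] at he
  rcases he with he | he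
  · exact he
  · have h2 := fst_mem_of_mem_steps he
    have h3 := snd_mem_of_mem_steps he
    have := (List.nodup_cons.1 h).1
    rcases h1 with h1 | h1
    · rw [h1] at h2; exact absurd h2 this
    · rw [h1] at h3; exact absurd h3 this

/-- A function takes the same value at both ends of a list if it does not change along steps. -/
theorem eq_of_steps_eq {β : Type*} (g : α → β) {l : List α} (h : ∀ e ∈ steps l, g e.1 = g e.2)
    {a b : α} (ha : a ∈ l) (hb : b ∈ l) : g a = g b := by
  have key : ∀ (l : List α) (c : α), (∀ e ∈ steps (c :: l), g e.1 = g e.2) →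
      ∀ x ∈ c :: l, g x = g c := by
    intro l
    induction l with
    | nil => intro c _ x hx; simp at hx; rw [hx]
    | cons d t ih =>
      intro c hc x hx
      have h1 : g c = g d := hc (c, d) (by simp)
      rcases List.mem_cons.1 hx with rfl | hx
      · rfl
      · rw [h1]; exact ih d (fun e he => hc e (by simp [he])) x hx
  cases l with
  | nil => simp at ha
  | cons c t => rw [key t c h a ha, key t c h b hb]

end Steps

/-! ### Lattice steps and the edges they cross

The dual vertex `(p, q)` stands for the point `(p - 1/2, q - 1/2)`, the south-west corner of the
unit square around the vertex `(p, q)`. -/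

theorem adj_iff {p q : ℤ × ℤ} : squareLattice.Adj p q ↔
    (q.1 = p.1 + 1 ∧ q.2 = p.2) ∨ (q.1 = p.1 - 1 ∧ q.2 = p.2) ∨
    (q.1 = p.1 ∧ q.2 = p.2 + 1) ∨ (q.1 = p.1 ∧ q.2 = p.2 - 1) := by
  change |p.1 - q.1| + |p.2 - q.2| = 1 ↔ _
  rcases abs_cases (p.1 - q.1) with ⟨h, _⟩ | ⟨h, _⟩ <;>
  rcases abs_cases (p.2 - q.2) with ⟨h', _⟩ | ⟨h', _⟩ <;> rw [h, h'] <;> omega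

/-- The edge of the lattice crossed by a step between two adjacent dual vertices. -/
def cross (e : (ℤ × ℤ) × (ℤ × ℤ)) : Sym2 (ℤ × ℤ) :=
  s((min e.1.1 e.2.1 - |e.2.2 - e.1.2|, min e.1.2 e.2.2 - |e.2.1 - e.1.1|),
    (min e.1.1 e.2.1, min e.1.2 e.2.2))

theorem cross_swap (e : (ℤ × ℤ) × (ℤ × ℤ)) : cross e.swap = cross e := by
  simp only [cross, Prod.fst_swap, Prod.snd_swap, min_comm e.2.1, min_comm e.2.2,
    abs_sub_comm e.1.1, abs_sub_comm e.1.2]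

theorem cross_horizontal (a b : ℤ) : cross ((a, b), (a + 1, b)) = s((a, b - 1), (a, b)) := by
  simp [cross]

theorem cross_vertical (a b : ℤ) : cross ((a, b), (a, b + 1)) = s((a - 1, b), (a, b)) := by
  simp [cross]

theorem cross_horizontal' (a b : ℤ) : cross ((a + 1, b), (a, b)) = s((a, b - 1), (a, b)) := by
  rw [← cross_horizontal, ← cross_swap]; rfl

theorem cross_vertical' (a b : ℤ) : cross ((a, b + 1), (a, b)) = s((a - 1, b), (a, b)) := by
  rw [← cross_vertical, ← cross_swap]; rfl

/-- Up to order, a dual step is horizontal or vertical. -/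
theorem step_cases {e : (ℤ × ℤ) × (ℤ × ℤ)} (h : squareLattice.Adj e.1 e.2) :
    ∃ a b : ℤ, e = ((a, b), (a + 1, b)) ∨ e = ((a + 1, b), (a, b)) ∨
      e = ((a, b), (a, b + 1)) ∨ e = ((a, b + 1), (a, b)) := by
  obtain ⟨⟨a, b⟩, ⟨c, d⟩⟩ := e
  rcases adj_iff.1 h with ⟨h1, h2⟩ | ⟨h1, h2⟩ | ⟨h1, h2⟩ | ⟨h1, h2⟩ <;> simp only at h1 h2 <;>
    subst h2
  · subst h1; exact ⟨a, d, Or.inl rfl⟩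
  · refine ⟨c, d, Or.inr (Or.inl ?_)⟩; rw [h1]; simp
  · subst h1; exact ⟨c, b, by simp⟩
  · subst h1; exact ⟨c, b - 1, by simp⟩

theorem cross_injective {e f : (ℤ × ℤ) × (ℤ × ℤ)} (he : squareLattice.Adj e.1 e.2)
    (hf : squareLattice.Adj f.1 f.2) (h : cross e = cross f) : f = e ∨ f = e.swap := by
  obtain ⟨a, b, rfl | rfl | rfl | rfl⟩ := step_cases he <;>
  obtain ⟨c, d, rfl | rfl | rfl | rfl⟩ := step_cases hf <;>
  simp only [cross_horizontal, cross_vertical, cross_horizontal', cross_vertical', Sym2.eq_iff,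
    Prod.mk.injEq, Prod.swap] at h ⊢ <;> omega

/-! ### Signed crossing numbers -/

/-- The contribution of a dual step to the signed number of crossings of the vertical ray that
goes up from the vertex `v`. -/
def upCross (v : ℤ × ℤ) (e : (ℤ × ℤ) × (ℤ × ℤ)) : ℤ :=
  if min e.1.1 e.2.1 = v.1 ∧ v.2 < e.1.2 then e.2.1 - e.1.1 else 0

/-- The signed number of crossings of a dual path with the vertical ray going up from `v`. -/
def upIndex (l : List (ℤ × ℤ)) (v : ℤ × ℤ) : ℤ := ((steps l).map (upCross v)).sum

/-- The indicator function of the points above the edge from `v` to its right neighbour. -/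
def above (v p : ℤ × ℤ) : ℤ := if p.1 = v.1 + 1 ∧ v.2 < p.2 then 1 else 0

/-- The difference of the two counts is the net flow into the vertical half-line of dual vertices
between the two rays. The lower end of this half-line can be passed only by crossing the excluded
edge, so the flow telescopes to its values at the endpoints. -/
theorem upIndex_right {l : List (ℤ × ℤ)} (hl : ∀ e ∈ steps l, squareLattice.Adj e.1 e.2)
    {a b : ℤ × ℤ} (ha : l.head? = some a) (hb : l.getLast? = some b) {v : ℤ × ℤ}
    (hv : ∀ e ∈ steps l, cross e ≠ s(v, (v.1 + 1, v.2))) :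
    upIndex l v - upIndex l (v.1 + 1, v.2) = above v b - above v a := by
  rw [← sum_steps_telescope (above v) (fun e => upCross v e - upCross (v.1 + 1, v.2) e) ha hb]
  · unfold upIndex
    induction steps l with
    | nil => simp
    | cons e t ih => simp only [List.map_cons, List.sum_cons, ← ih]; ring
  · intro e he
    have h1 := hv e he
    obtain ⟨x, y⟩ := v
    obtain ⟨a, b, rfl | rfl | rfl | rfl⟩ := step_cases (hl e he) <;>
    simp only [cross_horizontal, cross_vertical, cross_horizontal', cross_vertical', ne_eq,
      Sym2.eq_iff, Prod.mk.injEq] at h1 <;>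
    simp only [upCross, above] <;> split_ifs <;> omega

theorem upIndex_up {l : List (ℤ × ℤ)} (hl : ∀ e ∈ steps l, squareLattice.Adj e.1 e.2)
    {v : ℤ × ℤ} (hv : ∀ e ∈ steps l, cross e ≠ s(v, (v.1, v.2 + 1))) :
    upIndex l v = upIndex l (v.1, v.2 + 1) := by
  unfold upIndex
  congr 1
  refine List.map_congr_left fun e he => ?_
  have h1 := hv e he
  obtain ⟨x, y⟩ := v
  obtain ⟨a, b, rfl | rfl | rfl | rfl⟩ := step_cases (hl e he) <;>
  simp only [cross_horizontal, cross_vertical, cross_horizontal', cross_vertical', ne_eq,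
    Sym2.eq_iff, Prod.mk.injEq] at h1 <;>
  simp only [upCross] <;> split_ifs <;> omega

/-- For a closed path the index is constant along edges that are not crossed. -/
theorem upIndex_eq_of_adj {l : List (ℤ × ℤ)} (hl : ∀ e ∈ steps l, squareLattice.Adj e.1 e.2)
    (hc : l.head? = l.getLast?) {v w : ℤ × ℤ} (hvw : squareLattice.Adj v w)
    (hv : ∀ e ∈ steps l, cross e ≠ s(v, w)) : upIndex l v = upIndex l w := by
  cases l with
  | nil => rfl
  | cons a t =>
    have ha : (a :: t).head? = some a := rfl
    have hb : (a :: t).getLast? = some a := hc ▸ ha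
    obtain ⟨x, y⟩ := v
    obtain ⟨z, w⟩ := w
    rcases adj_iff.1 hvw with ⟨h1, h2⟩ | ⟨h1, h2⟩ | ⟨h1, h2⟩ | ⟨h1, h2⟩ <;> simp only at h1 h2 <;>
      rw [h1, h2] at hv ⊢
    · have := upIndex_right hl ha hb hv
      simp only at this; linarith
    · have := upIndex_right (v := (x - 1, y)) hl ha hb
        (by simpa [Sym2.eq_swap (a := (x, y))] using hv)
      simp only [sub_add_cancel] at this; linarith
    · exact upIndex_up hl hv
    · have := upIndex_up (v := (x, y - 1)) hl
        (by simpa [Sym2.eq_swap (a := (x, y))] using hv)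
      simp only [sub_add_cancel] at this; exact this.symm

/-! ### Contours as edge boundaries -/

/-- A finite connected set of vertices such that no vertex outside it is enclosed by it. -/
structure IsRegion (I : Set (ℤ × ℤ)) : Prop where
  finite : I.Finite
  conn : ∀ P : ℤ × ℤ → Prop, (∀ u ∈ I, ∀ v ∈ I, squareLattice.Adj u v → P u → P v) →
    ∀ u ∈ I, P u → ∀ v ∈ I, P v
  infinite_of_notMem : ∀ v ∉ I, ∀ S : Set (ℤ × ℤ), v ∈ S →
    (∀ u ∈ S, u ∉ I → ∀ w ∉ I, squareLattice.Adj u w → w ∈ S) → S.Infinite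

/-- The set of edges with exactly one endpoint in `I`. -/
def edgeBoundary (I : Set (ℤ × ℤ)) : Set (Sym2 (ℤ × ℤ)) :=
  {e | ∃ u ∈ I, ∃ v ∉ I, squareLattice.Adj u v ∧ e = s(u, v)}

theorem mem_edgeBoundary_iff {I : Set (ℤ × ℤ)} {u v : ℤ × ℤ} (h : squareLattice.Adj u v) :
    s(u, v) ∈ edgeBoundary I ↔ ¬ (u ∈ I ↔ v ∈ I) := by
  constructor
  · rintro ⟨a, ha, b, hb, -, hab⟩
    rcases Sym2.eq_iff.1 hab with ⟨rfl, rfl⟩ | ⟨rfl, rfl⟩ <;> tauto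
  · intro hne
    by_cases hu : u ∈ I
    · exact ⟨u, hu, v, by tauto, h, rfl⟩
    · exact ⟨v, by tauto, u, hu, h.symm, Sym2.eq_swap⟩

theorem latticeMinus_adj {γ : Set (Sym2 (ℤ × ℤ))} {u v : ℤ × ℤ} :
    (latticeMinus γ).Adj u v ↔ squareLattice.Adj u v ∧ s(u, v) ∉ γ := by
  simp [latticeMinus, SimpleGraph.deleteEdges_adj]

theorem mem_of_reachable {V : Type*} {G : SimpleGraph V} {S : Set V}
    (hS : ∀ u ∈ S, ∀ v, G.Adj u v → v ∈ S) {u v : V} (hu : u ∈ S) (h : G.Reachable u v) :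
    v ∈ S := by
  rw [SimpleGraph.reachable_iff_reflTransGen] at h
  induction h with
  | refl => exact hu
  | tail _ h ih => exact hS _ ih _ h

theorem supp_mk {V : Type*} {G : SimpleGraph V} (v : V) :
    (G.connectedComponentMk v).supp = {w | G.Reachable v w} := by
  ext w
  rw [SimpleGraph.ConnectedComponent.mem_supp_iff, SimpleGraph.ConnectedComponent.eq]
  exact ⟨fun h => h.symm, fun h => h.symm⟩

theorem mem_vertexInterior {γ : Finset (Sym2 (ℤ × ℤ))} {v : ℤ × ℤ} :
    v ∈ vertexInterior γ ↔ {w | (latticeMinus γ).Reachable v w}.Finite := by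
  rw [← supp_mk]; rfl

theorem mem_vertexInterior_of_adj {γ : Finset (Sym2 (ℤ × ℤ))} {v w : ℤ × ℤ}
    (h : (latticeMinus γ).Adj v w) (hv : v ∈ vertexInterior γ) : w ∈ vertexInterior γ := by
  rw [mem_vertexInterior] at hv ⊢
  exact hv.subset fun x hx => h.reachable.trans hx

/-- An edge of `γ` with both ends inside or both ends outside could be put back while the interior
component stays finite, against minimality. A boundary edge missing from `γ` would join an outer
vertex to the finite component. -/
theorem coe_eq_edgeBoundary {γ : Finset (Sym2 (ℤ × ℤ))} (hγ : IsContour γ) :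
    (γ : Set (Sym2 (ℤ × ℤ))) = edgeBoundary (vertexInterior γ) := by
  ext e
  constructor
  · intro he
    induction e with
    | _ u v =>
    have hadj : squareLattice.Adj u v := hγ.subset_edgeSet he
    rw [mem_edgeBoundary_iff hadj]
    intro hiff
    obtain ⟨C, hC, -⟩ := hγ.existsUnique_finite
    have hCI := hγ.vertexInterior_eq C hC
    obtain ⟨c, rfl⟩ := C.exists_rep
    have hc : c ∈ vertexInterior γ := hC
    refine hγ.minimal _ he ((latticeMinus _).connectedComponentMk c) ?_
    rw [supp_mk]
    refine Set.Finite.subset (hCI ▸ hC : (vertexInterior γ).Finite) fun w hw => ?_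
    refine mem_of_reachable (S := vertexInterior γ) ?_ hc hw
    intro a ha b hab
    rw [latticeMinus_adj] at hab
    by_cases hg : s(a, b) ∈ (γ : Set (Sym2 (ℤ × ℤ)))
    · have : s(a, b) = s(u, v) := by
        by_contra hne
        exact hab.2 ⟨hg, hne⟩
      rcases Sym2.eq_iff.1 this with ⟨rfl, rfl⟩ | ⟨rfl, rfl⟩ <;> tauto
    · exact mem_vertexInterior_of_adj (latticeMinus_adj.2 ⟨hab.1, hg⟩) ha
  · rintro ⟨u, hu, v, hv, hadj, rfl⟩
    by_contra hg
    exact hv (mem_vertexInterior_of_adj (latticeMinus_adj.2 ⟨hadj, hg⟩) hu)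

theorem IsContour.isRegion {γ : Finset (Sym2 (ℤ × ℤ))} (hγ : IsContour γ) :
    IsRegion (vertexInterior γ) := by
  have hb := coe_eq_edgeBoundary hγ
  obtain ⟨C, hC, -⟩ := hγ.existsUnique_finite
  have hCI := hγ.vertexInterior_eq C hC
  refine ⟨hCI ▸ hC, ?_, ?_⟩
  · intro P hP u hu hPu v hv
    have huv : (latticeMinus γ).Reachable u v := by
      rw [hCI, SimpleGraph.ConnectedComponent.mem_supp_iff] at hu hv
      exact SimpleGraph.ConnectedComponent.exact (hu.trans hv.symm)
    refine (mem_of_reachable (S := {w | w ∈ vertexInterior γ ∧ P w}) ?_ ⟨hu, hPu⟩ huv).2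
    rintro a ⟨ha, hPa⟩ b hab
    have hbI := mem_vertexInterior_of_adj hab ha
    exact ⟨hbI, hP a ha b hbI (latticeMinus_adj.1 hab).1 hPa⟩
  · intro v hv S hvS hS hfin
    refine hv (mem_vertexInterior.2 (hfin.subset fun w hw => ?_))
    refine (mem_of_reachable (S := {w | w ∉ vertexInterior γ ∧ w ∈ S}) ?_ ⟨hv, hvS⟩ hw).2
    rintro a ⟨ha, haS⟩ b hab
    have hbI : b ∉ vertexInterior γ := fun hbI => ha (mem_vertexInterior_of_adj hab.symm hbI)
    exact ⟨hbI, hS a haS ha b hbI (latticeMinus_adj.1 hab).1⟩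

/-! ### From regions back to contours -/

section Converse

variable {I : Set (ℤ × ℤ)} {γ : Finset (Sym2 (ℤ × ℤ))}

theorem IsRegion.vertexInterior_eq (hI : IsRegion I)
    (hγ : (γ : Set (Sym2 (ℤ × ℤ))) = edgeBoundary I) : vertexInterior γ = I := by
  ext v
  rw [mem_vertexInterior]
  constructor
  · intro hfin
    by_contra hv
    refine hI.infinite_of_notMem v hv _ (SimpleGraph.Reachable.refl v) ?_ hfin
    intro u hu huI w hwI huw
    refine SimpleGraph.Reachable.trans hu (SimpleGraph.Adj.reachable ?_)
    rw [latticeMinus_adj, hγ, mem_edgeBoundary_iff huw]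
    tauto
  · intro hv
    refine hI.finite.subset fun w hw => mem_of_reachable ?_ hv hw
    intro a ha b hab
    rw [latticeMinus_adj, hγ] at hab
    by_contra hb
    exact hab.2 ⟨a, ha, b, hb, hab.1, rfl⟩

/-- Needed to recognise the boundary of a hull as a contour. Minimality holds because one restored
edge connects all of `I` to an outer vertex, whose component is infinite. -/
theorem IsRegion.isContour (hI : IsRegion I) (hne : I.Nonempty)
    (hγ : (γ : Set (Sym2 (ℤ × ℤ))) = edgeBoundary I) : IsContour γ := by
  have hint := hI.vertexInterior_eq hγ
  obtain ⟨c, hc⟩ := hne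
  have hreach : ∀ δ : Set (Sym2 (ℤ × ℤ)), δ ⊆ γ → ∀ u ∈ I, ∀ v ∈ I,
      (latticeMinus δ).Reachable u v := by
    intro δ hδ u hu v hv
    refine hI.conn (fun w => (latticeMinus δ).Reachable u w) ?_ u hu (.refl u) v hv
    intro a ha b hb hab h
    refine h.trans (SimpleGraph.Adj.reachable ?_)
    rw [latticeMinus_adj]
    refine ⟨hab, fun hd => ?_⟩
    have := hδ hd
    rw [hγ, mem_edgeBoundary_iff hab] at this
    tauto
  refine ⟨?_, ?_, ?_⟩
  · rw [hγ]
    rintro _ ⟨u, -, v, -, h, rfl⟩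
    exact h
  · refine ⟨(latticeMinus γ).connectedComponentMk c, ?_, ?_⟩
    · change c ∈ vertexInterior γ
      rwa [hint]
    · intro C hC
      obtain ⟨v, rfl⟩ := C.exists_rep
      have hv : v ∈ vertexInterior γ := hC
      rw [hint] at hv
      exact SimpleGraph.ConnectedComponent.sound (hreach _ subset_rfl v hv c hc)
  · intro e he C hC
    rw [← Finset.mem_coe, hγ] at he
    obtain ⟨u, hu, o, ho, huo, rfl⟩ := he
    have key : ∀ v ∉ I, ¬ {w | (latticeMinus ((γ : Set (Sym2 (ℤ × ℤ))) \ {s(u, o)})).Reachable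
        v w}.Finite := by
      intro v hv
      refine hI.infinite_of_notMem v hv _ (SimpleGraph.Reachable.refl v) ?_
      intro a ha haI w hwI haw
      refine SimpleGraph.Reachable.trans ha (SimpleGraph.Adj.reachable ?_)
      rw [latticeMinus_adj, hγ, Set.mem_sdiff, mem_edgeBoundary_iff haw]
      tauto
    obtain ⟨v, rfl⟩ := C.exists_rep
    change ((latticeMinus _).connectedComponentMk v).supp.Finite at hC
    rw [supp_mk] at hC
    by_cases hv : v ∈ I
    · refine key o ho (hC.subset fun w hw => ?_)
      refine (hreach _ Set.sdiff_subset v hv u hu).trans (SimpleGraph.Reachable.trans ?_ hw)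
      refine SimpleGraph.Adj.reachable ?_
      rw [latticeMinus_adj]
      exact ⟨huo, fun h => h.2 rfl⟩
    · exact key v hv hC

end Converse

/-! ### The boundary cycle of a region -/

/-- A step across the vertical line through `v` has an end in column `v.1 + 1`, so controlling this
one column suffices. -/
theorem upIndex_eq_zero {l : List (ℤ × ℤ)} (hl : ∀ e ∈ steps l, squareLattice.Adj e.1 e.2)
    {v : ℤ × ℤ} (h : ∀ p ∈ l, p.1 = v.1 + 1 → p.2 ≤ v.2) : upIndex l v = 0 := by
  unfold upIndex
  refine List.sum_eq_zero fun x hx => ?_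
  obtain ⟨e, he, rfl⟩ := List.mem_map.1 hx
  have h1 := h _ (fst_mem_of_mem_steps he)
  have h2 := h _ (snd_mem_of_mem_steps he)
  obtain ⟨a, b, rfl | rfl | rfl | rfl⟩ := step_cases (hl e he) <;>
  simp only [upCross] at h1 h2 ⊢ <;> split_ifs <;> omega

/-- Here every crossing of the full vertical line counts, so the index is the net change of side. -/
theorem upIndex_of_right_above {l : List (ℤ × ℤ)}
    (hl : ∀ e ∈ steps l, squareLattice.Adj e.1 e.2) {a b : ℤ × ℤ} (ha : l.head? = some a)
    (hb : l.getLast? = some b) {v : ℤ × ℤ} (h : ∀ p ∈ l, p.1 = v.1 + 1 → v.2 < p.2) :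
    upIndex l v = (if v.1 < b.1 then 1 else 0) - (if v.1 < a.1 then 1 else 0) := by
  refine sum_steps_telescope (fun p => if v.1 < p.1 then 1 else 0) _ ha hb fun e he => ?_
  have h1 := h _ (fst_mem_of_mem_steps he)
  have h2 := h _ (snd_mem_of_mem_steps he)
  obtain ⟨a, b, rfl | rfl | rfl | rfl⟩ := step_cases (hl e he) <;>
  simp only [upCross] at h1 h2 ⊢ <;> split_ifs <;> omega

theorem upIndex_of_left_above {l : List (ℤ × ℤ)}
    (hl : ∀ e ∈ steps l, squareLattice.Adj e.1 e.2) {a b : ℤ × ℤ} (ha : l.head? = some a)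
    (hb : l.getLast? = some b) {v : ℤ × ℤ} (h : ∀ p ∈ l, p.1 = v.1 → v.2 < p.2) :
    upIndex l v = (if v.1 < b.1 then 1 else 0) - (if v.1 < a.1 then 1 else 0) := by
  refine sum_steps_telescope (fun p => if v.1 < p.1 then 1 else 0) _ ha hb fun e he => ?_
  have h1 := h _ (fst_mem_of_mem_steps he)
  have h2 := h _ (snd_mem_of_mem_steps he)
  obtain ⟨a, b, rfl | rfl | rfl | rfl⟩ := step_cases (hl e he) <;>
  simp only [upCross] at h1 h2 ⊢ <;> split_ifs <;> omega

theorem exists_abs_le (l : List (ℤ × ℤ)) : ∃ K : ℤ, ∀ p ∈ l, |p.1| ≤ K ∧ |p.2| ≤ K := by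
  induction l with
  | nil => exact ⟨0, by simp⟩
  | cons a t ih =>
    obtain ⟨K, hK⟩ := ih
    refine ⟨max K (max |a.1| |a.2|), fun p hp => ?_⟩
    rcases List.mem_cons.1 hp with rfl | hp
    · simp
    · have := hK p hp
      exact ⟨this.1.trans (le_max_left _ _), this.2.trans (le_max_left _ _)⟩

/-- Beside and above a bounding box there is nothing to cross; below it all crossings count and
cancel, as the path is closed. -/
theorem finite_upIndex_ne_zero {l : List (ℤ × ℤ)}
    (hl : ∀ e ∈ steps l, squareLattice.Adj e.1 e.2) (hc : l.head? = l.getLast?) :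
    {v | upIndex l v ≠ 0}.Finite := by
  obtain ⟨K, hK⟩ := exists_abs_le l
  refine (Set.finite_Icc ((-K - 1, -K - 1) : ℤ × ℤ) (K + 1, K + 1)).subset fun v hv => ?_
  simp only [Set.mem_ofPred_eq] at hv
  rw [Set.mem_Icc, Prod.le_def, Prod.le_def]
  have hx : -K - 1 ≤ v.1 ∧ v.1 ≤ K + 1 ∧ v.2 ≤ K + 1 := by
    by_contra hcon
    refine hv (upIndex_eq_zero hl fun p hp hpv => ?_)
    have h1 := abs_le.1 (hK p hp).1
    have h2 := abs_le.1 (hK p hp).2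
    omega
  have hy : -K - 1 ≤ v.2 := by
    by_contra hcon
    refine hv ?_
    cases l with
    | nil => rfl
    | cons a t =>
      rw [upIndex_of_right_above hl (a := a) (b := a) rfl (hc ▸ rfl)]
      · simp
      · intro p hp _
        have h2 := abs_le.1 (hK p hp).2
        omega
  exact ⟨⟨hx.1, hy⟩, hx.2.1, hx.2.2⟩

/-- A dual step that crosses the boundary of `I`. -/
def BoundaryStep (I : Set (ℤ × ℤ)) (p q : ℤ × ℤ) : Prop :=
  squareLattice.Adj p q ∧ cross (p, q) ∈ edgeBoundary I

theorem BoundaryStep.symm {I : Set (ℤ × ℤ)} {p q : ℤ × ℤ} (h : BoundaryStep I p q) :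
    BoundaryStep I q p :=
  ⟨h.1.symm, by rw [← cross_swap]; exact h.2⟩

theorem boundaryStep_right {I : Set (ℤ × ℤ)} {a b : ℤ} :
    BoundaryStep I (a, b) (a + 1, b) ↔ ¬ ((a, b - 1) ∈ I ↔ (a, b) ∈ I) := by
  rw [BoundaryStep, cross_horizontal, mem_edgeBoundary_iff (by simp [adj_iff])]
  simp [adj_iff]

theorem boundaryStep_up {I : Set (ℤ × ℤ)} {a b : ℤ} :
    BoundaryStep I (a, b) (a, b + 1) ↔ ¬ ((a - 1, b) ∈ I ↔ (a, b) ∈ I) := by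
  rw [BoundaryStep, cross_vertical, mem_edgeBoundary_iff (by simp [adj_iff])]
  simp [adj_iff]

theorem boundaryStep_left {I : Set (ℤ × ℤ)} {a b : ℤ} :
    BoundaryStep I (a, b) (a - 1, b) ↔ ¬ ((a - 1, b - 1) ∈ I ↔ (a - 1, b) ∈ I) := by
  rw [← boundaryStep_right, sub_add_cancel]
  exact ⟨.symm, .symm⟩

theorem boundaryStep_down {I : Set (ℤ × ℤ)} {a b : ℤ} :
    BoundaryStep I (a, b) (a, b - 1) ↔ ¬ ((a - 1, b - 1) ∈ I ↔ (a, b - 1) ∈ I) := by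
  rw [← boundaryStep_up, sub_add_cancel]
  exact ⟨.symm, .symm⟩

/-- Parity: going around the four lattice vertices that surround a dual vertex, membership in `I`
changes an even number of times. -/
theorem BoundaryStep.exists_ne {I : Set (ℤ × ℤ)} {p q : ℤ × ℤ} (h : BoundaryStep I p q) :
    ∃ r, r ≠ q ∧ BoundaryStep I p r := by
  obtain ⟨a, b⟩ := p
  by_contra! hcon
  have e1 : ∀ x : ℤ, ¬ x - 1 = x + 1 := fun x => by omega
  have e2 : ∀ x : ℤ, ¬ x + 1 = x - 1 := fun x => by omega
  have h1 := hcon (a + 1, b)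
  have h2 := hcon (a - 1, b)
  have h3 := hcon (a, b + 1)
  have h4 := hcon (a, b - 1)
  rw [boundaryStep_right] at h1
  rw [boundaryStep_left] at h2
  rw [boundaryStep_up] at h3
  rw [boundaryStep_down] at h4
  obtain ⟨c, d⟩ := q
  rcases adj_iff.1 h.1 with ⟨h5, h6⟩ | ⟨h5, h6⟩ | ⟨h5, h6⟩ | ⟨h5, h6⟩ <;> simp only at h5 h6 <;>
    subst h5 h6 <;> simp only [boundaryStep_right, boundaryStep_left, boundaryStep_up,
      boundaryStep_down] at h <;>
    simp [e1, e2] at h1 h2 h3 h4 <;> tauto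

/-- The dual vertex `p` is a corner of the unit square around the vertex `u`. -/
def IsCornerOf (p u : ℤ × ℤ) : Prop :=
  (p.1 = u.1 ∨ p.1 = u.1 + 1) ∧ (p.2 = u.2 ∨ p.2 = u.2 + 1)

theorem BoundaryStep.exists_isCornerOf {I : Set (ℤ × ℤ)} {p q : ℤ × ℤ} (h : BoundaryStep I p q) :
    ∃ u ∈ I, IsCornerOf p u := by
  obtain ⟨h1, u, hu, v, -, -, he⟩ := h
  refine ⟨u, hu, ?_⟩
  obtain ⟨x, y⟩ := u
  obtain ⟨z, w⟩ := v
  obtain ⟨a, b, h | h | h | h⟩ := step_cases (e := (p, q)) h1 <;> rw [h] at he <;>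
  simp only [Prod.mk.injEq] at h <;> obtain ⟨rfl, rfl⟩ := h <;>
  simp only [cross_horizontal, cross_vertical, cross_horizontal', cross_vertical',
    Sym2.eq_iff, Prod.mk.injEq, IsCornerOf] at he ⊢ <;> omega

/-- The closed path `z, t, z` is a simple cycle of steps that cross the boundary of `I`. -/
structure IsBoundaryCycle (I : Set (ℤ × ℤ)) (z : ℤ × ℤ) (t : List (ℤ × ℤ)) : Prop where
  nodup : (z :: t).Nodup
  two_le : 2 ≤ t.length
  step : ∀ e ∈ steps (z :: (t ++ [z])), BoundaryStep I e.1 e.2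

theorem finite_isCornerOf {I : Set (ℤ × ℤ)} (hI : I.Finite) :
    {p | ∃ u ∈ I, IsCornerOf p u}.Finite := by
  have : {p : ℤ × ℤ | ∃ u ∈ I, IsCornerOf p u} ⊆ ⋃ u ∈ I, Set.Icc u (u.1 + 1, u.2 + 1) := by
    rintro p ⟨u, hu, h1, h2⟩
    simp only [Set.mem_iUnion, Set.mem_Icc, Prod.le_def]
    exact ⟨u, hu, by omega⟩
  exact (hI.biUnion fun u _ => Set.finite_Icc _ _).subset this

/-- A simple path of boundary steps can always be prolonged at its head. If it never closed up, it
would outgrow the finite set of corners of `I`. -/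
theorem exists_isBoundaryCycle {I : Set (ℤ × ℤ)} (hI : I.Finite) {p q : ℤ × ℤ}
    (hpq : BoundaryStep I p q) : ∃ z t, IsBoundaryCycle I z t := by
  by_contra! hcon
  have key : ∀ n : ℕ, ∃ v u t, (v :: u :: t : List (ℤ × ℤ)).Nodup ∧ t.length = n ∧
      ∀ e ∈ steps (v :: u :: t), BoundaryStep I e.1 e.2 := by
    intro n
    induction n with
    | zero =>
      refine ⟨p, q, [], ?_, rfl, by simpa using hpq⟩
      simpa using hpq.1.ne
    | succ n ih =>
      obtain ⟨v, u, t, hnd, hlen, hst⟩ := ih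
      have hvu : BoundaryStep I v u := hst (v, u) (by simp)
      obtain ⟨r, hru, hvr⟩ := hvu.exists_ne
      -- The new vertex differs from `v` and `u`, so hitting the path closes a cycle with at least
      -- three vertices.
      by_cases hr : r ∈ v :: u :: t
      · exfalso
        have hrv : r ≠ v := hvr.1.ne'
        have hrt : r ∈ t := by
          simp only [List.mem_cons] at hr; tauto
        obtain ⟨t₁, t₂, rfl⟩ := List.append_of_mem hrt
        refine hcon r (v :: u :: t₁) ⟨?_, by simp, ?_⟩
        · have h1 : (v :: u :: t₁ ++ r :: t₂).Nodup := by simpa using hnd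
          have h2 := (List.nodup_middle.1 h1)
          rw [← List.cons_append] at h2
          exact h2.of_append_left
        · intro e he
          simp only [List.cons_append, steps_cons_cons, List.mem_cons] at he
          rcases he with rfl | rfl | he
          · exact hvr.symm
          · exact hvu
          · refine hst e ?_
            have : v :: u :: (t₁ ++ r :: t₂) = [v] ++ ((u :: (t₁ ++ [r])) ++ t₂) := by simp
            rw [this]
            exact mem_steps_append_right (mem_steps_append_left he)
      · refine ⟨r, v, u :: t, List.nodup_cons.2 ⟨hr, hnd⟩, by simp [hlen], ?_⟩
        intro e he
        rw [steps_cons_cons, List.mem_cons] at he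
        rcases he with rfl | he
        · exact hvr.symm
        · exact hst e he
  have hfin := finite_isCornerOf hI
  obtain ⟨v, u, t, hnd, hlen, hst⟩ := key hfin.toFinset.card
  have hsub : (v :: u :: t).toFinset ⊆ hfin.toFinset := by
    intro x hx
    rw [List.mem_toFinset] at hx
    rw [Set.Finite.mem_toFinset]
    rcases List.mem_cons.1 hx with rfl | hx
    · exact (hst (x, u) (by simp)).exists_isCornerOf
    · have : ∃ w, BoundaryStep I w x := by
        have hx' : x ∈ (steps (v :: u :: t)).map Prod.snd := by
          rw [steps, List.map_snd_zip (by simp)]; simpa using hx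
        obtain ⟨e, he, rfl⟩ := List.mem_map.1 hx'
        exact ⟨_, hst e he⟩
      obtain ⟨w, hw⟩ := this
      exact hw.symm.exists_isCornerOf
  have := Finset.card_le_card hsub
  rw [List.toFinset_card_of_nodup hnd] at this
  simp only [List.length_cons] at this
  omega

theorem IsBoundaryCycle.rotate {I : Set (ℤ × ℤ)} {z : ℤ × ℤ} {t : List (ℤ × ℤ)}
    (h : IsBoundaryCycle I z t) {a : ℤ × ℤ} (ha : a ∈ z :: t) : ∃ t', IsBoundaryCycle I a t' := by
  rcases List.mem_cons.1 ha with rfl | ha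
  · exact ⟨t, h⟩
  obtain ⟨s₁, s₂, rfl⟩ := List.append_of_mem ha
  refine ⟨s₂ ++ z :: s₁, ?_, ?_, ?_⟩
  · have h1 := h.nodup
    have : (z :: s₁ ++ a :: s₂).Perm (a :: s₂ ++ z :: s₁) := List.perm_append_comm
    exact this.nodup h1
  · have := h.two_le; simp at this ⊢; omega
  · intro e he
    have h1 : a :: (s₂ ++ z :: s₁ ++ [a]) = (a :: s₂) ++ z :: (s₁ ++ [a]) := by simp
    have h2 : z :: (s₁ ++ a :: s₂ ++ [z]) = (z :: s₁) ++ a :: (s₂ ++ [z]) := by simp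
    refine h.step e ?_
    rw [h1, steps_append_cons, List.mem_append] at he
    rw [h2, steps_append_cons, List.mem_append]
    exact he.symm

/-- Only the first step crosses the edge. The rest of the path obeys the rules for uncrossed edges,
up to its endpoint terms, and the indices on the two sides end up differing by one. -/
theorem upIndex_ne_of_cross {a b : ℤ × ℤ} {t : List (ℤ × ℤ)}
    (hl : ∀ e ∈ steps (a :: b :: t), squareLattice.Adj e.1 e.2)
    (hb : (b :: t).getLast? = some a) {v w : ℤ × ℤ} (hvw : cross (a, b) = s(v, w))
    (h : ∀ e ∈ steps (b :: t), cross e ≠ s(v, w)) :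
    upIndex (a :: b :: t) v ≠ upIndex (a :: b :: t) w := by
  wlog hle : v.1 ≤ w.1 ∧ v.2 ≤ w.2 generalizing v w with H
  · refine (H (hvw.trans Sym2.eq_swap) (by rwa [Sym2.eq_swap]) ?_).symm
    obtain ⟨x, y⟩ := v
    obtain ⟨z, w⟩ := w
    simp only [cross, Sym2.eq_iff, Prod.mk.injEq] at hvw
    simp only at hle ⊢
    have := abs_nonneg (b.2 - a.2)
    have := abs_nonneg (b.1 - a.1)
    omega
  have hl' : ∀ e ∈ steps (b :: t), squareLattice.Adj e.1 e.2 := fun e he => hl e (by simp [he])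
  have hexp : ∀ u, upIndex (a :: b :: t) u = upCross u (a, b) + upIndex (b :: t) u := by
    simp [upIndex]
  rw [hexp, hexp]
  obtain ⟨x, y⟩ := v
  obtain ⟨z, w⟩ := w
  obtain ⟨c, d, hs | hs | hs | hs⟩ := step_cases (hl (a, b) (by simp)) <;>
    rw [hs] at hvw ⊢ <;> obtain ⟨rfl, rfl⟩ := Prod.mk.injEq _ _ _ _ |>.mp hs <;>
    simp only [cross_horizontal, cross_vertical, cross_horizontal', cross_vertical',
      Sym2.eq_iff, Prod.mk.injEq] at hvw hle
  · obtain ⟨rfl, rfl, rfl, rfl⟩ : x = c ∧ y = d - 1 ∧ z = c ∧ w = d := by omega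
    have := upIndex_up (v := (z, w - 1)) hl' (by simpa using h)
    simp only [sub_add_cancel] at this
    simp [upCross, this]
  · obtain ⟨rfl, rfl, rfl, rfl⟩ : x = c ∧ y = d - 1 ∧ z = c ∧ w = d := by omega
    have := upIndex_up (v := (z, w - 1)) hl' (by simpa using h)
    simp only [sub_add_cancel] at this
    simp [upCross, this]
  · obtain ⟨rfl, rfl, rfl, rfl⟩ : x = c - 1 ∧ y = d ∧ z = c ∧ w = d := by omega
    have := upIndex_right (v := (z - 1, w)) hl' rfl hb (by simpa using h)
    simp [above] at this
    simp [upCross]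
    omega
  · obtain ⟨rfl, rfl, rfl, rfl⟩ : x = c - 1 ∧ y = d ∧ z = c ∧ w = d := by omega
    have := upIndex_right (v := (z - 1, w)) hl' rfl hb (by simpa using h)
    simp [above] at this
    simp [upCross]
    omega

theorem nodup_map_cross {l : List (ℤ × ℤ)} (hl : ∀ e ∈ steps l, squareLattice.Adj e.1 e.2)
    (hnd : l.Nodup) : ((steps l).map cross).Nodup := by
  induction l with
  | nil => simp
  | cons a t ih =>
    cases t with
    | nil => simp
    | cons b t =>
      rw [steps_cons_cons, List.map_cons, List.nodup_cons]
      refine ⟨?_, ih (fun e he => hl e (by simp [he])) hnd.of_cons⟩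
      rw [List.mem_map]
      rintro ⟨e, he, hcr⟩
      have ha := (List.nodup_cons.1 hnd).1
      rcases cross_injective (hl _ (by simp)) (hl e (by simp [he])) hcr.symm with rfl | rfl
      · exact ha (fst_mem_of_mem_steps he)
      · exact ha (snd_mem_of_mem_steps he)

section Cycle

variable {I : Set (ℤ × ℤ)} {z : ℤ × ℤ} {t : List (ℤ × ℤ)}

/-- Distinct vertices leave only an immediate return as a danger, and a cycle of at least three
vertices has none. -/
theorem IsBoundaryCycle.cross_notMem (h : IsBoundaryCycle I z t) {b : ℤ × ℤ} {s : List (ℤ × ℤ)}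
    (ht : t ++ [z] = b :: s) : ∀ e ∈ steps (b :: s), cross e ≠ cross (z, b) := by
  have hst := h.step
  rw [ht] at hst
  have hadj : ∀ e ∈ steps (z :: b :: s), squareLattice.Adj e.1 e.2 := fun e he => (hst e he).1
  obtain ⟨c, r, rfl⟩ : ∃ c r, t = b :: c :: r := by
    have := h.two_le
    match t, this, ht with
    | b' :: c :: r, _, ht => simp at ht; exact ⟨c, r, by rw [ht.1]⟩
  obtain rfl : s = c :: (r ++ [z]) := by simpa using ht.symm
  have hnd : (b :: c :: (r ++ [z])).Nodup := by
    have : (z :: (b :: c :: r)).Perm (b :: c :: r ++ [z]) := (List.perm_append_singleton _ _).symm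
    exact this.nodup h.nodup
  intro e he hcr
  have hzc : z ≠ c := by
    intro hzc; have := h.nodup; simp [hzc] at this
  have hzb : z ≠ b := by
    intro hzb; have := h.nodup; simp [hzb] at this
  rcases cross_injective (hadj _ (by simp)) (hadj e (List.mem_cons_of_mem _ he)) hcr.symm with
    rfl | rfl
  · have := nodup_steps_mem_head hnd he (Or.inr rfl)
    simp at this; exact hzb this.1
  · have := nodup_steps_mem_head hnd he (Or.inl rfl)
    simp at this; exact hzc this

theorem exists_concat_eq_cons {α : Type*} (t : List α) (z : α) : ∃ b s, t ++ [z] = b :: s :=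
  List.exists_cons_of_ne_nil (by simp)

theorem IsBoundaryCycle.nodup_cross (h : IsBoundaryCycle I z t) :
    ((steps (z :: (t ++ [z]))).map cross).Nodup := by
  obtain ⟨b, s, hbs⟩ := exists_concat_eq_cons t z
  have h1 := h.cross_notMem hbs
  have h2 := h.step
  have hnd : (t ++ [z]).Nodup := (List.perm_append_singleton _ _).nodup_iff.2 h.nodup
  rw [hbs] at h2 hnd ⊢
  rw [steps_cons_cons, List.map_cons, List.nodup_cons]
  refine ⟨?_, nodup_map_cross (fun e he => (h2 e (by simp [he])).1) hnd⟩
  rw [List.mem_map]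
  rintro ⟨e, he, hcr⟩
  exact h1 e he hcr

/-- A single boundary cycle exhausts the boundary. Its index vanishes off `I`, where a nonzero value
would spread to an infinite set; it is constant on the connected set `I`, and nonzero there because
it changes across the first step. Hence it changes across every boundary edge, which is then
crossed. -/
theorem IsBoundaryCycle.exists_cross_eq (h : IsBoundaryCycle I z t) (hI : IsRegion I)
    {f : Sym2 (ℤ × ℤ)} (hf : f ∈ edgeBoundary I) :
    ∃ e ∈ steps (z :: (t ++ [z])), cross e = f := by
  set l := z :: (t ++ [z]) with hldef
  have hl : ∀ e ∈ steps l, squareLattice.Adj e.1 e.2 := fun e he => (h.step e he).1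
  have hc : l.head? = l.getLast? := by
    rw [hldef, ← List.cons_append, List.getLast?_append]; simp
  have hsupp := finite_upIndex_ne_zero hl hc
  have hout : ∀ v ∉ I, upIndex l v = 0 := by
    intro v hv
    by_contra hne
    refine hI.infinite_of_notMem v hv {w | upIndex l w = upIndex l v} rfl ?_
      (hsupp.subset fun w hw => by rw [Set.mem_ofPred_eq] at hw ⊢; rwa [hw])
    intro u hu huI w hwI huw
    rw [Set.mem_ofPred_eq] at hu ⊢
    rw [← hu]
    refine (upIndex_eq_of_adj hl hc huw fun e he hce => ?_).symm
    have := (h.step e he).2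
    rw [Prod.mk.eta, hce, mem_edgeBoundary_iff huw] at this
    tauto
  have hin : ∀ u ∈ I, ∀ v ∈ I, upIndex l v = upIndex l u := by
    intro u hu v hv
    refine hI.conn (fun w => upIndex l w = upIndex l u) ?_ u hu rfl v hv
    intro a ha b hb hab hau
    rw [← hau]
    refine (upIndex_eq_of_adj hl hc hab fun e he hce => ?_).symm
    have := (h.step e he).2
    rw [Prod.mk.eta, hce, mem_edgeBoundary_iff hab] at this
    tauto
  obtain ⟨b, s, hbs⟩ := exists_concat_eq_cons t z
  have hl0 : l = z :: b :: s := by rw [hldef, hbs]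
  obtain ⟨u, hu, o, ho, huo, hcr⟩ : cross (z, b) ∈ edgeBoundary I :=
    (h.step (z, b) (by rw [hbs]; simp)).2
  have hne : upIndex l u ≠ upIndex l o := by
    rw [hl0]
    refine upIndex_ne_of_cross (by rw [← hl0]; exact hl) ?_ hcr ?_
    · rw [← hbs]; simp
    · rw [← hcr]; exact h.cross_notMem hbs
  rw [hout o ho] at hne
  obtain ⟨u', hu', o', ho', huo', rfl⟩ := hf
  by_contra! hcon
  have := upIndex_eq_of_adj hl hc huo' hcon
  rw [hout o' ho', hin u hu u' hu'] at this
  exact hne this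

end Cycle

@[simp] theorem getLast?_cons_concat {α : Type*} (a : α) (l : List α) (b : α) :
    (a :: (l ++ [b])).getLast? = some b := by
  rw [← List.cons_append, List.getLast?_concat]

/-! ### Disjoint dual paths -/

/-- This and `upIndex_shift_up` follow the index along a second dual path, read at the lattice
vertex just south-east of each dual vertex. With this offset, having no common vertices is enough to
exclude crossings. -/
theorem upIndex_shift_right {l : List (ℤ × ℤ)} (hl : ∀ e ∈ steps l, squareLattice.Adj e.1 e.2)
    {a b : ℤ × ℤ} (ha : l.head? = some a) (hb : l.getLast? = some b) {x y : ℤ}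
    (h : (x + 1, y) ∉ l) : upIndex l (x, y - 1) - upIndex l (x + 1, y - 1) =
      above (x, y - 1) b - above (x, y - 1) a := by
  refine upIndex_right (v := (x, y - 1)) hl ha hb fun e he hcr => h ?_
  have h1 := cross_vertical (x + 1) (y - 1)
  rw [add_sub_cancel_right, sub_add_cancel] at h1
  rcases cross_injective (e := ((x + 1, y - 1), (x + 1, y))) (by simp [adj_iff]) (hl e he)
    (h1.trans hcr.symm) with rfl | rfl
  · exact snd_mem_of_mem_steps he
  · exact fst_mem_of_mem_steps he

theorem upIndex_shift_up {l : List (ℤ × ℤ)} (hl : ∀ e ∈ steps l, squareLattice.Adj e.1 e.2)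
    {x y : ℤ} (h : (x, y) ∉ l) : upIndex l (x, y - 1) = upIndex l (x, y) := by
  have := upIndex_up (v := (x, y - 1)) hl fun e he hcr => h ?_
  · simpa using this
  · have h1 := cross_horizontal x y
    rw [sub_add_cancel] at hcr
    rcases cross_injective (e := ((x, y), (x + 1, y))) (by simp [adj_iff]) (hl e he)
      (h1.trans hcr.symm) with rfl | rfl
    · exact fst_mem_of_mem_steps he
    · exact snd_mem_of_mem_steps he

/-- A path from `a` to `c` and a path disjoint from it that contains `c'` and `b` cannot exist
if the vertical rays down from `a` and `c` avoid the second path and `c'` lies between the two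
rays and below the first path, whereas `b` lies above the first path. -/
theorem false_of_disjoint_paths {l m : List (ℤ × ℤ)} {a b c c' : ℤ × ℤ}
    (hl : ∀ e ∈ steps l, squareLattice.Adj e.1 e.2)
    (hm : ∀ e ∈ steps m, squareLattice.Adj e.1 e.2)
    (ha : l.head? = some a) (hc : l.getLast? = some c) (hc' : c' ∈ m) (hb : b ∈ m)
    (hdisj : ∀ p ∈ l, p ∉ m) (h1 : ∀ p ∈ m, p.1 = a.1 → a.2 < p.2)
    (h2 : ∀ p ∈ m, p.1 = c.1 → c.2 < p.2) (h3 : ∀ p ∈ l, p.1 = b.1 + 1 → p.2 < b.2)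
    (h4 : ∀ p ∈ l, p.1 = c'.1 + 1 → c'.2 < p.2) (hac : a.1 ≤ c'.1) (hcc : c'.1 < c.1) :
    False := by
  -- The index seen from `m` is constant since the two downward rays remove the endpoint terms; yet
  -- it is 1 at `c'` and 0 at `b`.
  have key := eq_of_steps_eq (fun p : ℤ × ℤ => upIndex l (p.1, p.2 - 1)) (l := m) ?_ hc' hb
  · rw [upIndex_eq_zero (v := (b.1, b.2 - 1)) hl, upIndex_of_right_above (v := (c'.1, c'.2 - 1))
      hl ha hc] at key
    · split_ifs at key <;> simp only at * <;> omega
    · intro p hp hpc; have := h4 p hp hpc; simp only; omega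
    · intro p hp hpc; have := h3 p hp hpc; simp only; omega
  · have hR : ∀ x y : ℤ, (x + 1, y) ∈ m → upIndex l (x, y - 1) = upIndex l (x + 1, y - 1) := by
      intro x y hxy
      have h := upIndex_shift_right hl ha hc fun h => hdisj _ h hxy
      have h5 := h1 _ hxy
      have h6 := h2 _ hxy
      simp only [above] at h h5 h6
      rw [if_neg (by omega), if_neg (by omega)] at h
      linarith
    have hU : ∀ x y : ℤ, (x, y) ∈ m → upIndex l (x, y - 1) = upIndex l (x, y) := fun x y hxy =>
      upIndex_shift_up hl fun h => hdisj _ h hxy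
    intro e he
    have hf := fst_mem_of_mem_steps he
    have hs := snd_mem_of_mem_steps he
    obtain ⟨x, y, rfl | rfl | rfl | rfl⟩ := step_cases (hm e he) <;>
      simp only [add_sub_cancel_right] at hf hs ⊢
    · exact hR x y hs
    · exact (hR x y hf).symm
    · exact hU x y hf
    · exact (hU x y hs).symm

/-- A path from `c` to `d` separates `a` and `b` if the ray down from `c` and the ray up from `d`
can be used as barriers; a path disjoint from it cannot contain both. -/
theorem false_of_separating_path {l m : List (ℤ × ℤ)} {a b c d : ℤ × ℤ}
    (hl : ∀ e ∈ steps l, squareLattice.Adj e.1 e.2)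
    (hm : ∀ e ∈ steps m, squareLattice.Adj e.1 e.2)
    (hc : l.head? = some c) (hd : l.getLast? = some d) (ha : a ∈ m) (hb : b ∈ m)
    (hdisj : ∀ p ∈ l, p ∉ m) (h1 : ∀ p ∈ m, p.1 = c.1 → c.2 < p.2)
    (h2 : ∀ p ∈ m, p.1 = d.1 → p.2 < d.2) (h3 : ∀ p ∈ l, p.1 = a.1 → a.2 < p.2)
    (h4 : ∀ p ∈ l, p.1 = b.1 + 1 → p.2 < b.2) (hac : a.1 < c.1) (hdb : d.1 ≤ b.1) :
    False := by
  -- The index jumps when `m` passes below the end `d`; the added indicator compensates this. The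
  -- sum is 0 at `a` and 1 at `b`.
  have key := eq_of_steps_eq (fun p : ℤ × ℤ => upIndex l (p.1, p.2 - 1) +
    if d.1 ≤ p.1 then 1 else 0) (l := m) ?_ ha hb
  · rw [upIndex_eq_zero (v := (b.1, b.2 - 1)) hl, upIndex_of_left_above (v := (a.1, a.2 - 1))
      hl hc hd] at key
    · split_ifs at key <;> simp only at * <;> omega
    · intro p hp hpc; have := h3 p hp hpc; simp only; omega
    · intro p hp hpc; have := h4 p hp hpc; simp only; omega
  · have hR : ∀ x y : ℤ, (x + 1, y) ∈ m → upIndex l (x, y - 1) + (if d.1 ≤ x then 1 else 0) =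
        upIndex l (x + 1, y - 1) + if d.1 ≤ x + 1 then 1 else 0 := by
      intro x y hxy
      have h := upIndex_shift_right hl hc hd fun h => hdisj _ h hxy
      have h5 := h1 _ hxy
      have h6 := h2 _ hxy
      simp only [above] at h h5 h6
      rw [if_neg (c := c.1 = _ ∧ _) (by omega)] at h
      split_ifs at h ⊢ <;> omega
    have hU : ∀ x y : ℤ, (x, y) ∈ m → upIndex l (x, y - 1) = upIndex l (x, y) := fun x y hxy =>
      upIndex_shift_up hl fun h => hdisj _ h hxy
    intro e he
    have hf := fst_mem_of_mem_steps he
    have hs := snd_mem_of_mem_steps he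
    obtain ⟨x, y, rfl | rfl | rfl | rfl⟩ := step_cases (hm e he) <;>
      simp only [add_sub_cancel_right] at hf hs ⊢
    · exact hR x y hs
    · exact (hR x y hf).symm
    · rw [hU x y hf]
    · rw [hU x y hs]

/-! ### Corners with a free quadrant -/

/-- The points of `I` that have no other point of `I` in their south-east quadrant. -/
def IsSouthEast (I : Set (ℤ × ℤ)) (u : ℤ × ℤ) : Prop :=
  u ∈ I ∧ ∀ w ∈ I, u.1 ≤ w.1 → w.2 ≤ u.2 → w = u

/-- The points of `I` that have no other point of `I` in their north-west quadrant. -/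
def IsNorthWest (I : Set (ℤ × ℤ)) (u : ℤ × ℤ) : Prop :=
  u ∈ I ∧ ∀ w ∈ I, w.1 ≤ u.1 → u.2 ≤ w.2 → w = u

/-- The points of `I` that have no other point of `I` in their south-west quadrant. -/
def IsSouthWest (I : Set (ℤ × ℤ)) (u : ℤ × ℤ) : Prop :=
  u ∈ I ∧ ∀ w ∈ I, w.1 ≤ u.1 → w.2 ≤ u.2 → w = u

/-- The points of `I` that have no other point of `I` in their north-east quadrant. -/
def IsNorthEast (I : Set (ℤ × ℤ)) (u : ℤ × ℤ) : Prop :=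
  u ∈ I ∧ ∀ w ∈ I, u.1 ≤ w.1 → u.2 ≤ w.2 → w = u

section Quadrants

variable {I : Set (ℤ × ℤ)} {u p : ℤ × ℤ}

/-- In an empty quadrant a path that stays near `I` can visit only the apex. This turns rays from
the apex into barriers for paths that avoid it. -/
theorem IsSouthEast.eq_corner (hu : IsSouthEast I u) (hp : ∃ w ∈ I, IsCornerOf p w)
    (h1 : u.1 + 1 ≤ p.1) (h2 : p.2 ≤ u.2) : p = (u.1 + 1, u.2) := by
  obtain ⟨w, hw, hx, hy⟩ := hp
  obtain rfl := hu.2 w hw (by omega) (by omega)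
  ext <;> simp only <;> omega

theorem IsNorthWest.eq_corner (hu : IsNorthWest I u) (hp : ∃ w ∈ I, IsCornerOf p w)
    (h1 : p.1 ≤ u.1) (h2 : u.2 + 1 ≤ p.2) : p = (u.1, u.2 + 1) := by
  obtain ⟨w, hw, hx, hy⟩ := hp
  obtain rfl := hu.2 w hw (by omega) (by omega)
  ext <;> simp only <;> omega

theorem IsSouthWest.eq_corner (hu : IsSouthWest I u) (hp : ∃ w ∈ I, IsCornerOf p w)
    (h1 : p.1 ≤ u.1) (h2 : p.2 ≤ u.2) : p = u := by
  obtain ⟨w, hw, hx, hy⟩ := hp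
  obtain rfl := hu.2 w hw (by omega) (by omega)
  ext <;> omega

theorem IsNorthEast.eq_corner (hu : IsNorthEast I u) (hp : ∃ w ∈ I, IsCornerOf p w)
    (h1 : u.1 + 1 ≤ p.1) (h2 : u.2 + 1 ≤ p.2) : p = (u.1 + 1, u.2 + 1) := by
  obtain ⟨w, hw, hx, hy⟩ := hp
  obtain rfl := hu.2 w hw (by omega) (by omega)
  ext <;> simp only <;> omega

end Quadrants

/-! ### The two arcs of the boundary cycle -/

/-- `l` is a simple dual path around `I` from the south-west corner of `a` to the north-east
corner of `b`. -/
structure IsArc (I : Set (ℤ × ℤ)) (a b : ℤ × ℤ) (l : List (ℤ × ℤ)) : Prop where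
  nodup : l.Nodup
  adj : ∀ e ∈ steps l, squareLattice.Adj e.1 e.2
  near : ∀ p ∈ l, ∃ u ∈ I, IsCornerOf p u
  head : l.head? = some a
  last : l.getLast? = some (b.1 + 1, b.2 + 1)

/-- The rays down from `a` and from the corner of `u` close off the region below `l`. The path `m`
is trapped there at the corner of `u'`, but has to reach the corner of `b` above. -/
theorem false_of_southEast {I : Set (ℤ × ℤ)} {a b u u' : ℤ × ℤ} {l m : List (ℤ × ℤ)}
    (ha : IsSouthWest I a) (hb : IsNorthEast I b) (hu : IsSouthEast I u) (hu' : IsSouthEast I u')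
    (hl : ∀ e ∈ steps l, squareLattice.Adj e.1 e.2) (hln : ∀ p ∈ l, ∃ u ∈ I, IsCornerOf p u)
    (hm : ∀ e ∈ steps m, squareLattice.Adj e.1 e.2) (hmn : ∀ p ∈ m, ∃ u ∈ I, IsCornerOf p u)
    (hla : l.head? = some a) (hlu : l.getLast? = some (u.1 + 1, u.2))
    (hmu : (u'.1 + 1, u'.2) ∈ m) (hmb : (b.1 + 1, b.2 + 1) ∈ m)
    (hdisj : ∀ p ∈ l, p ∉ m) (hau : a.1 ≤ u'.1) (huu : u'.1 < u.1) : False := by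
  have hal : a ∈ l := List.mem_of_head? hla
  have hul : (u.1 + 1, u.2) ∈ l := List.mem_of_getLast? hlu
  refine false_of_disjoint_paths hl hm hla hlu hmu hmb hdisj ?_ ?_ ?_ ?_ (by simp only; omega)
    (by simp only; omega)
  · intro p hp hpa
    by_contra hcon
    obtain rfl := ha.eq_corner (hmn p hp) (by omega) (by omega)
    exact hdisj _ hal hp
  · intro p hp hpu
    by_contra hcon
    simp only at hpu hcon
    obtain rfl := hu.eq_corner (hmn p hp) (by omega) (by omega)
    exact hdisj _ hul hp
  · intro p hp hpb
    by_contra hcon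
    simp only at hpb hcon
    have := hb.eq_corner (hln p hp) (by omega) (by omega)
    rw [this] at hpb; simp at hpb
  · intro p hp hpb
    by_contra hcon
    simp only at hpb hcon
    have := hu'.eq_corner (hln p hp) (by omega) (by omega)
    rw [this] at hpb; simp at hpb

theorem IsNorthEast.ne_southEast {I : Set (ℤ × ℤ)} {b u : ℤ × ℤ} (hb : IsNorthEast I b)
    (hu : IsSouthEast I u) : (u.1 + 1, u.2) ≠ (b.1 + 1, b.2 + 1) := by
  intro h
  simp only [Prod.mk.injEq] at h
  obtain rfl := hu.2 b hb.1 (by omega) (by omega)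
  omega

section Arcs

variable {I : Set (ℤ × ℤ)} {a b : ℤ × ℤ}

/-- South-east corners occur on an arc in increasing order. -/
theorem IsArc.southEast_mem_right {l s₁ s₂ : List (ℤ × ℤ)} (hl : IsArc I a b l)
    (ha : IsSouthWest I a) (hb : IsNorthEast I b) {u u' : ℤ × ℤ} (hu : IsSouthEast I u)
    (hu' : IsSouthEast I u') (hau : a.1 ≤ u'.1) (huu : u'.1 < u.1)
    (hs : l = s₁ ++ (u'.1 + 1, u'.2) :: s₂) (hmem : (u.1 + 1, u.2) ∈ l) :
    (u.1 + 1, u.2) ∈ s₂ := by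
  have hmem' := hmem
  rw [hs, List.mem_append, List.mem_cons] at hmem'
  rcases hmem' with h | h | h
  · exfalso
    obtain ⟨r₁, r₂, rfl⟩ := List.append_of_mem h
    have hl1 : l = (r₁ ++ [(u.1 + 1, u.2)]) ++ (r₂ ++ (u'.1 + 1, u'.2) :: s₂) := by simp [hs]
    have hnd := hl.nodup
    rw [hl1] at hnd
    refine false_of_southEast (l := r₁ ++ [(u.1 + 1, u.2)]) (m := (u'.1 + 1, u'.2) :: s₂)
      ha hb hu hu' ?_ ?_ ?_ ?_ ?_ ?_ ?_ ?_ ?_ hau huu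
    · intro e he; exact hl.adj e (hl1 ▸ mem_steps_append_left he)
    · intro p hp; exact hl.near p (hl1 ▸ List.mem_append_left _ hp)
    · intro e he; exact hl.adj e (hs ▸ mem_steps_append_right he)
    · intro p hp; exact hl.near p (hs ▸ List.mem_append_right _ hp)
    · have := hl.head; rw [hl1] at this; cases r₁ <;> simpa using this
    · simp
    · simp
    · refine List.mem_of_getLast? ?_
      have := hl.last; rw [hs, List.getLast?_append] at this
      simpa using this
    · intro p hp hp'
      exact (List.disjoint_of_nodup_append hnd) hp (List.mem_append_right _ hp')
  · simp only [Prod.mk.injEq] at h; omega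
  · exact h

/-- South-east corners cannot be spread over both arcs: the piece of `l` up to the corner of `u` and
the piece of `m` from the corner of `u'` on would be disjoint. -/
theorem IsArc.false_of_mem_of_mem {l m : List (ℤ × ℤ)} (hl : IsArc I a b l) (hm : IsArc I a b m)
    (hlm : ∀ p ∈ l, p ∈ m → p = a ∨ p = (b.1 + 1, b.2 + 1))
    (ha : IsSouthWest I a) (hb : IsNorthEast I b) {u u' : ℤ × ℤ} (hu : IsSouthEast I u)
    (hu' : IsSouthEast I u') (hau : a.1 ≤ u'.1) (huu : u'.1 < u.1)
    (hul : (u.1 + 1, u.2) ∈ l) (hum : (u'.1 + 1, u'.2) ∈ m) : False := by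
  obtain ⟨r₁, r₂, h1⟩ := List.append_of_mem hul
  obtain ⟨s₁, s₂, h2⟩ := List.append_of_mem hum
  have h1' : l = (r₁ ++ [(u.1 + 1, u.2)]) ++ r₂ := by simp [h1]
  refine false_of_southEast (l := r₁ ++ [(u.1 + 1, u.2)]) (m := (u'.1 + 1, u'.2) :: s₂)
    ha hb hu hu' ?_ ?_ ?_ ?_ ?_ ?_ ?_ ?_ ?_ hau huu
  · intro e he; exact hl.adj e (h1' ▸ mem_steps_append_left he)
  · intro p hp; exact hl.near p (h1' ▸ List.mem_append_left _ hp)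
  · intro e he; exact hm.adj e (h2 ▸ mem_steps_append_right he)
  · intro p hp; exact hm.near p (h2 ▸ List.mem_append_right _ hp)
  · have := hl.head; rw [h1] at this; cases r₁ <;> simpa using this
  · simp
  · simp
  · refine List.mem_of_getLast? ?_
    have := hm.last; rw [h2, List.getLast?_append] at this
    simpa using this
  · intro p hp hp'
    have hpl : p ∈ l := h1' ▸ List.mem_append_left _ hp
    have hpm : p ∈ m := h2 ▸ List.mem_append_right _ hp'
    -- The common endpoints are harmless: `a` comes before the piece of `m`, and the north-east
    -- corner comes after the piece of `l`.
    rcases hlm p hpl hpm with rfl | rfl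
    · have hnd := hm.nodup
      have hh := hm.head
      rw [h2] at hnd hh
      cases s₁ with
      | nil =>
        simp only [List.nil_append, List.head?_cons, Option.some.injEq] at hh
        have := congrArg Prod.fst hh
        simp only at this
        omega
      | cons x s =>
        simp only [List.cons_append, List.head?_cons, Option.some.injEq] at hh
        subst hh
        exact (List.disjoint_of_nodup_append hnd) (List.mem_cons_self) hp'
    · have hnd := hl.nodup
      have hh := hl.last
      rw [h1'] at hnd hh
      rcases List.eq_nil_or_concat r₂ with rfl | ⟨t, x, rfl⟩
      · simp only [List.append_nil, List.getLast?_append, List.getLast?_singleton] at hh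
        exact hb.ne_southEast hu (by simpa using hh)
      · obtain rfl : x = (b.1 + 1, b.2 + 1) := by simpa using hh
        exact (List.disjoint_of_nodup_append hnd) hp (by simp)

theorem exists_segment {l : List (ℤ × ℤ)} (hl : ∀ e ∈ steps l, squareLattice.Adj e.1 e.2)
    {c d : ℤ × ℤ} (hc : c ∈ l) (hd : d ∈ l) : ∃ m, (∀ e ∈ steps m, squareLattice.Adj e.1 e.2) ∧
      m.head? = some c ∧ m.getLast? = some d ∧ ∀ p ∈ m, p ∈ l := by
  obtain ⟨s₁, s₂, rfl⟩ := List.append_of_mem hc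
  rw [List.mem_append, List.mem_cons] at hd
  rcases hd with h | rfl | h
  · obtain ⟨r₁, r₂, rfl⟩ := List.append_of_mem h
    refine ⟨(d :: r₂ ++ [c]).reverse, ?_, by simp, by simp, ?_⟩
    · intro e he
      rw [steps_reverse, List.mem_reverse, List.mem_map] at he
      obtain ⟨f, hf, rfl⟩ := he
      refine (hl f ?_).symm
      have : r₁ ++ d :: r₂ ++ c :: s₂ = r₁ ++ ((d :: r₂ ++ [c]) ++ s₂) := by simp
      rw [this]
      exact mem_steps_append_right (mem_steps_append_left hf)
    · intro p hp
      simp only [List.mem_reverse, List.mem_append, List.mem_cons, List.not_mem_nil] at hp ⊢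
      tauto
  · exact ⟨[d], by simp, rfl, rfl, by simp⟩
  · obtain ⟨r₁, r₂, rfl⟩ := List.append_of_mem h
    refine ⟨c :: r₁ ++ [d], ?_, by simp, by simp, ?_⟩
    · intro e he
      refine hl e ?_
      have : s₁ ++ c :: (r₁ ++ d :: r₂) = s₁ ++ ((c :: r₁ ++ [d]) ++ r₂) := by simp
      rw [this]
      exact mem_steps_append_right (mem_steps_append_left he)
    · intro p hp
      simp only [List.mem_append, List.mem_cons, List.not_mem_nil] at hp ⊢
      tauto

/-- A south-east and a north-west corner do not lie on the same arc. -/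
theorem IsArc.false_of_southEast_northWest {l m : List (ℤ × ℤ)} (hl : IsArc I a b l)
    (hm : IsArc I a b m) (hlm : ∀ p ∈ l, p ∈ m → p = a ∨ p = (b.1 + 1, b.2 + 1))
    (ha : IsSouthWest I a) (hb : IsNorthEast I b) {u w : ℤ × ℤ} (hu : IsSouthEast I u)
    (hw : IsNorthWest I w) (hau : a.1 ≤ u.1) (haw : a.2 ≤ w.2)
    (hul : (u.1 + 1, u.2) ∈ l) (hwl : (w.1, w.2 + 1) ∈ l) : False := by
  have hua : (u.1 + 1, u.2) ≠ a := by
    rintro rfl; simp only at hau; omega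
  have hwa : (w.1, w.2 + 1) ≠ a := by
    rintro rfl; simp only at haw; omega
  have hub := hb.ne_southEast hu
  have hwb : (w.1, w.2 + 1) ≠ (b.1 + 1, b.2 + 1) := by
    intro h
    simp only [Prod.mk.injEq] at h
    obtain rfl := hb.2 w hw.1 (by omega) (by omega)
    omega
  obtain ⟨r, rfl⟩ : ∃ r, l = a :: r := by
    have := hl.head
    cases l with
    | nil => simp at this
    | cons x r => simp at this; exact ⟨r, by rw [this]⟩
  rcases List.eq_nil_or_concat r with rfl | ⟨t, x, rfl⟩
  · exact hua (by simpa using hul)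
  obtain rfl : x = (b.1 + 1, b.2 + 1) := by simpa using hl.last
  rw [List.concat_eq_append] at hl hlm hul hwl
  -- The segment is taken in `l` without its two ends, the only points shared with `m`.
  obtain ⟨s, hs, hsc, hsd, hst⟩ := exists_segment (l := t) (c := (u.1 + 1, u.2))
    (d := (w.1, w.2 + 1))
    (fun e he => hl.adj e (by
      have : a :: (t ++ [(b.1 + 1, b.2 + 1)]) = [a] ++ (t ++ [(b.1 + 1, b.2 + 1)]) := by simp
      rw [this]; exact mem_steps_append_right (mem_steps_append_left he)))
    (by simp at hul hua hub ⊢; tauto) (by simp at hwl hwa hwb ⊢; tauto)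
  have hsl : ∀ p ∈ s, p ∈ a :: (t ++ [(b.1 + 1, b.2 + 1)]) := fun p hp => by
    have := hst p hp; simp [this]
  have hnd := hl.nodup
  have hdisj : ∀ p ∈ s, p ∉ m := by
    intro p hp hpm
    rcases hlm p (hsl p hp) hpm with rfl | rfl
    · exact (List.nodup_cons.1 hnd).1 (List.mem_append_left _ (hst _ hp))
    · exact List.disjoint_of_nodup_append (List.nodup_cons.1 hnd).2 (hst _ hp) (by simp)
  have hcs := List.mem_of_head? hsc
  have hds := List.mem_of_getLast? hsd
  refine false_of_separating_path hs hm.adj hsc hsd (List.mem_of_head? hm.head)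
    (List.mem_of_getLast? hm.last) hdisj ?_ ?_ ?_ ?_ (by simp only; omega) ?_
  · intro p hp hpu
    by_contra hcon
    simp only at hpu hcon
    obtain rfl := hu.eq_corner (hm.near p hp) (by omega) (by omega)
    exact hdisj _ hcs hp
  · intro p hp hpw
    by_contra hcon
    simp only at hpw hcon
    obtain rfl := hw.eq_corner (hm.near p hp) (by omega) (by omega)
    exact hdisj _ hds hp
  · intro p hp hpa
    by_contra hcon
    obtain rfl := ha.eq_corner (hl.near p (hsl p hp)) (by omega) (by omega)
    exact hdisj _ hp (List.mem_of_head? hm.head)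
  · intro p hp hpb
    by_contra hcon
    simp only at hpb hcon
    have := hb.eq_corner (hl.near p (hsl p hp)) (by omega) (by omega)
    rw [this] at hpb; simp at hpb
  · simp only
    by_contra hcon
    by_cases h : b.2 ≤ w.2
    · obtain rfl := hb.2 w hw.1 (by omega) h
      omega
    · obtain rfl := hw.2 b hb.1 (by omega) (by omega)
      omega

end Arcs

/-! ### Words of dual paths -/

/-- The four directions, encoded as (vertical or not, positive or not). -/
abbrev Dir := Bool × Bool

/-- The direction of a step. -/
def dir (e : (ℤ × ℤ) × (ℤ × ℤ)) : Dir :=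
  (decide (e.2.1 = e.1.1), decide (e.1.1 < e.2.1 ∨ e.1.2 < e.2.2))

/-- The direction to the right. -/
abbrev east : Dir := (false, true)

/-- The upward direction. -/
abbrev north : Dir := (true, true)

/-- The sequence of directions of a path. -/
def word (l : List (ℤ × ℤ)) : List Dir := (steps l).map dir

theorem word_append_cons (l₁ : List (ℤ × ℤ)) (a : ℤ × ℤ) (l₂ : List (ℤ × ℤ)) :
    word (l₁ ++ a :: l₂) = word (l₁ ++ [a]) ++ word (a :: l₂) := by
  simp [word, steps_append_cons l₁ a l₂]

theorem word_cons_cons (a b : ℤ × ℤ) (l : List (ℤ × ℤ)) :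
    word (a :: b :: l) = dir (a, b) :: word (b :: l) := by
  simp [word]

theorem length_word (l : List (ℤ × ℤ)) : (word l).length = l.length - 1 := by
  simp [word, length_steps]

theorem replicate_east_sublist {l : List (ℤ × ℤ)}
    (hl : ∀ e ∈ steps l, squareLattice.Adj e.1 e.2) {p q : ℤ × ℤ} (hp : l.head? = some p)
    (hq : l.getLast? = some q) {k : ℕ} (hk : p.1 + k ≤ q.1) :
    (List.replicate k east).Sublist (word l) := by
  induction l generalizing p k with
  | nil => simp at hp
  | cons a t ih =>
    obtain rfl : a = p := by simpa using hp
    cases t with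
    | nil =>
      obtain rfl : a = q := by simpa using hq
      obtain rfl : k = 0 := by omega
      simp
    | cons b t =>
      rw [word_cons_cons]
      have hab := hl (a, b) (by simp)
      have ih' := @ih (fun e he => hl e (by simp [he])) b rfl (by simpa using hq)
      cases k with
      | zero => simp
      | succ k =>
        by_cases hb : b.1 = a.1 + 1
        · have : dir (a, b) = east := by simp [dir, hb]
          rw [this, List.replicate_succ]
          exact (ih' (by push_cast at hk; omega)).cons_cons _
        · refine (ih' ?_).cons _
          have := adj_iff.1 hab
          simp only at this
          omega

theorem replicate_north_sublist {l : List (ℤ × ℤ)}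
    (hl : ∀ e ∈ steps l, squareLattice.Adj e.1 e.2) {p q : ℤ × ℤ} (hp : l.head? = some p)
    (hq : l.getLast? = some q) {k : ℕ} (hk : p.2 + k ≤ q.2) :
    (List.replicate k north).Sublist (word l) := by
  induction l generalizing p k with
  | nil => simp at hp
  | cons a t ih =>
    obtain rfl : a = p := by simpa using hp
    cases t with
    | nil =>
      obtain rfl : a = q := by simpa using hq
      obtain rfl : k = 0 := by omega
      simp
    | cons b t =>
      rw [word_cons_cons]
      have hab := adj_iff.1 (hl (a, b) (by simp))
      simp only at hab
      have ih' := @ih (fun e he => hl e (by simp [he])) b rfl (by simpa using hq)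
      cases k with
      | zero => simp
      | succ k =>
        by_cases hb : b.2 = a.2 + 1
        · have : dir (a, b) = north := by
            have : b.1 = a.1 := by omega
            simp [dir, hb, this]
          rw [this, List.replicate_succ]
          exact (ih' (by push_cast at hk; omega)).cons_cons _
        · refine (ih' ?_).cons _
          omega

theorem le_length_of_adj {l : List (ℤ × ℤ)} (hl : ∀ e ∈ steps l, squareLattice.Adj e.1 e.2)
    {p q : ℤ × ℤ} (hp : l.head? = some p) (hq : l.getLast? = some q) :
    (q.1 - p.1) + (q.2 - p.2) + 1 ≤ l.length := by
  induction l generalizing p with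
  | nil => simp at hp
  | cons a t ih =>
    obtain rfl : a = p := by simpa using hp
    cases t with
    | nil =>
      obtain rfl : a = q := by simpa using hq
      simp
    | cons b t =>
      have hab := adj_iff.1 (hl (a, b) (by simp))
      simp only at hab
      have ih' := @ih (fun e he => hl e (by simp [he])) b rfl (by simpa using hq)
      rw [List.length_cons]
      push_cast
      omega

/-- The first upward passage of a path from row `j` to row `j + 1`. -/
theorem exists_first_passage {l : List (ℤ × ℤ)}
    (hl : ∀ e ∈ steps l, squareLattice.Adj e.1 e.2) {p q : ℤ × ℤ} (hp : l.head? = some p)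
    (hq : l.getLast? = some q) {j : ℤ} (hpj : p.2 ≤ j) (hqj : j < q.2) :
    ∃ s₁ r s₂, l = s₁ ++ r :: (r.1, r.2 + 1) :: s₂ ∧ r.2 = j ∧ ∀ y ∈ s₁ ++ [r], y.2 ≤ j := by
  induction l generalizing p with
  | nil => simp at hp
  | cons a t ih =>
    obtain rfl : a = p := by simpa using hp
    cases t with
    | nil =>
      obtain rfl : a = q := by simpa using hq
      omega
    | cons b t =>
      have hab := adj_iff.1 (hl (a, b) (by simp))
      simp only at hab
      by_cases hb : b.2 ≤ j
      · obtain ⟨s₁, r, s₂, h1, h2, h3⟩ :=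
          @ih (fun e he => hl e (by simp [he])) b rfl (by simpa using hq) hb
        refine ⟨a :: s₁, r, s₂, by simp [h1], h2, fun y hy => ?_⟩
        rw [List.cons_append, List.mem_cons] at hy
        rcases hy with rfl | hy
        · exact hpj
        · exact h3 y hy
      · refine ⟨[], a, t, ?_, by omega, by simpa using hpj⟩
        have : b = (a.1, a.2 + 1) := by ext <;> simp only <;> omega
        simp [this]

/-! ### Staircase words -/

open Classical in
/-- The word of length `n` of the staircase that starts at `p` and goes east at the points that
satisfy `H` and north at the other ones. -/
noncomputable def stairWord (H : ℤ × ℤ → Prop) : ℕ → ℤ × ℤ → List Dir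
  | 0, _ => []
  | n + 1, p => if H p then east :: stairWord H n (p.1 + 1, p.2)
      else north :: stairWord H n (p.1, p.2 + 1)

theorem length_stairWord (H : ℤ × ℤ → Prop) (n : ℕ) (p : ℤ × ℤ) :
    (stairWord H n p).length = n := by
  induction n generalizing p with
  | zero => rfl
  | succ n ih => rw [stairWord]; split_ifs <;> simp [ih]

theorem stairWord_add_east {H : ℤ × ℤ → Prop} {k n : ℕ} {i j : ℤ}
    (h : ∀ t : ℕ, t < k → H (i + t, j)) :
    stairWord H (k + n) (i, j) = List.replicate k east ++ stairWord H n (i + k, j) := by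
  induction k generalizing i with
  | zero => simp
  | succ k ih =>
    rw [Nat.succ_add, stairWord, if_pos (by simpa using h 0 (by simp)), List.replicate_succ,
      List.cons_append, ih]
    · push_cast
      congr 4
      ring
    · intro t ht
      have := h (t + 1) (by omega)
      push_cast at this
      rwa [add_comm (t : ℤ) 1, ← add_assoc] at this

theorem stairWord_eq_north {H : ℤ × ℤ → Prop} {n : ℕ} {i j : ℤ} (h : ∀ t, ¬ H (i, t)) :
    stairWord H n (i, j) = List.replicate n north := by
  induction n generalizing j with
  | zero => rfl
  | succ n ih => rw [stairWord, if_neg (h j), ih, List.replicate_succ]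

/-- The point `v` has a point of `I` in its south-east quadrant. -/
def SeesSouthEast (I : Set (ℤ × ℤ)) (v : ℤ × ℤ) : Prop := ∃ u ∈ I, v.1 ≤ u.1 ∧ u.2 ≤ v.2

/-- The point `v` has a point of `I` in its north-west quadrant. -/
def SeesNorthWest (I : Set (ℤ × ℤ)) (v : ℤ × ℤ) : Prop := ∃ u ∈ I, u.1 ≤ v.1 ∧ v.2 ≤ u.2

/-- Take a rightmost point among those of height at most `j`, then the lowest point of its column.
-/
theorem SeesSouthEast.exists_isSouthEast {I : Set (ℤ × ℤ)} (hI : I.Finite) {i j : ℤ}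
    (h : SeesSouthEast I (i, j)) : ∃ u, IsSouthEast I u ∧ i ≤ u.1 ∧ u.2 ≤ j ∧
      ∀ w ∈ I, w.2 ≤ j → w.1 ≤ u.1 := by
  obtain ⟨w, hw, hiw, hwj⟩ := h
  obtain ⟨u, ⟨hu, huj⟩, humax⟩ := Set.exists_max_image {w | w ∈ I ∧ w.2 ≤ j} (fun w => w.1)
    (hI.subset fun x hx => hx.1) ⟨w, hw, hwj⟩
  obtain ⟨v, ⟨hv, hvu⟩, hvmin⟩ := Set.exists_min_image {w | w ∈ I ∧ w.1 = u.1} (fun w => w.2)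
    (hI.subset fun x hx => hx.1) ⟨u, hu, rfl⟩
  have h1 := humax w ⟨hw, hwj⟩
  have h2 := hvmin u ⟨hu, rfl⟩
  simp only at h1 h2 hiw
  refine ⟨v, ⟨hv, fun y hy hvy hyv => ?_⟩, by omega, by omega, fun y hy hyj => ?_⟩
  · have h3 := humax y ⟨hy, by omega⟩
    have h4 : y.1 = u.1 := by omega
    have h5 := hvmin y ⟨hy, h4⟩
    ext <;> omega
  · have := humax y ⟨hy, hyj⟩
    omega

/-- Staircase and path are read in parallel. The invariant is that the current path point `p` lies
weakly south-west of the staircase point and that all corners from column `i` on are still ahead;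
the path then owes at least as many east and north steps as the staircase takes. -/
theorem stairWord_sublist_aux {I : Set (ℤ × ℤ)} (hI : I.Finite) {x q : ℤ × ℤ} (hx : x ∈ I)
    {H : ℤ × ℤ → Prop}
    (hH : ∀ i j, 0 ≤ i → i ≤ x.1 → 0 ≤ j → j ≤ x.2 → (H (i, j) ↔ SeesSouthEast I (i, j)))
    (hH' : ∀ j, ¬ H (x.1 + 1, j)) {l : List (ℤ × ℤ)}
    (hl : ∀ e ∈ steps l, squareLattice.Adj e.1 e.2) (hnear : ∀ p ∈ l, ∃ u ∈ I, IsCornerOf p u)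
    (hq : l.getLast? = some q) (hxq : x.2 + 1 ≤ q.2)
    (hord : ∀ u u' s₁ s₂, IsSouthEast I u → IsSouthEast I u' → 0 ≤ u'.1 → u'.1 < u.1 →
      l = s₁ ++ (u'.1 + 1, u'.2) :: s₂ → (u.1 + 1, u.2) ∈ l → (u.1 + 1, u.2) ∈ s₂)
    (n : ℕ) (i j : ℤ) (hi : 0 ≤ i) (hix : i ≤ x.1) (hj : 0 ≤ j) (hjx : j ≤ x.2)
    (hn : (n : ℤ) = (x.1 - i) + (x.2 - j)) (s₀ : List (ℤ × ℤ)) (p : ℤ × ℤ) (s : List (ℤ × ℤ))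
    (hs : l = s₀ ++ p :: s) (hpi : p.1 ≤ i) (hpj : p.2 ≤ j)
    (hcor : ∀ u, IsSouthEast I u → i ≤ u.1 → (u.1 + 1, u.2) ∈ p :: s) :
    (stairWord H (n + 2) (i, j)).Sublist (word (p :: s)) := by
  induction n using Nat.strong_induction_on generalizing i j s₀ p s with
  | _ n ih =>
  have hadj : ∀ e ∈ steps (p :: s), squareLattice.Adj e.1 e.2 := fun e he =>
    hl e (hs ▸ mem_steps_append_right he)
  have hlast : (p :: s).getLast? = some q := by
    rw [hs, List.getLast?_append] at hq
    simpa using hq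
  by_cases hij : SeesSouthEast I (i, j)
  · obtain ⟨u, hu, hiu, huj, humax⟩ := hij.exists_isSouthEast hI
    obtain ⟨s₁, s₂, h12⟩ := List.append_of_mem (hcor u hu hiu)
    have hpos : ∀ t : ℤ, i ≤ t → t ≤ u.1 → t ≤ x.1 → H (t, j) := fun t h1 h2 h3 =>
      (hH t j (by omega) h3 hj hjx).2 ⟨u, hu.1, h2, huj⟩
    have hrun : ∀ k : ℕ, p.1 + k ≤ u.1 + 1 →
        (List.replicate k east).Sublist (word (s₁ ++ [(u.1 + 1, u.2)])) := by
      intro k hk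
      refine replicate_east_sublist (p := p) (q := (u.1 + 1, u.2)) ?_ ?_ (by simp) hk
      · intro e he
        refine hadj e ?_
        rw [h12, steps_append_cons]
        exact List.mem_append_left _ he
      · have : (p :: s).head? = some p := rfl
        rw [h12] at this
        cases s₁ <;> simpa using this
    rw [h12, word_append_cons]
    -- The staircase runs east beneath which `u` stays visible, and the path must reach the corner
    -- of `u`. If `u` lies at or beyond the right side of the rectangle, only north steps remain
    -- afterwards.
    by_cases hux : u.1 < x.1
    · obtain ⟨k, hk⟩ := Int.eq_ofNat_of_zero_le (a := u.1 + 1 - i) (by omega)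
      obtain ⟨m, rfl⟩ : ∃ m, n = k + m := ⟨n - k, by omega⟩
      rw [add_assoc, stairWord_add_east fun t ht => hpos _ (by omega) (by omega) (by omega)]
      refine (hrun k (by omega)).append ?_
      refine ih m (by omega) (i + k) j (by omega) (by omega) hj hjx (by push_cast at hn; omega)
        (s₀ ++ s₁) _ s₂ (by rw [hs, h12, List.append_assoc]) (by simp only; omega) huj ?_
      intro w hw hiw
      refine List.mem_cons_of_mem _ (hord w u (s₀ ++ s₁) s₂ hw hu (by omega) (by omega)
        (by rw [hs, h12, List.append_assoc]) ?_)
      rw [hs]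
      exact List.mem_append_right _ (hcor w hw (by omega))
    · obtain ⟨k, hk⟩ := Int.eq_ofNat_of_zero_le (a := x.1 + 1 - i) (by omega)
      obtain ⟨m, hm⟩ : ∃ m, n + 2 = k + m := ⟨n + 2 - k, by omega⟩
      rw [hm, stairWord_add_east fun t ht => hpos _ (by omega) (by omega) (by omega)]
      refine (hrun k (by omega)).append ?_
      rw [← hk, add_sub_cancel, stairWord_eq_north hH']
      refine replicate_north_sublist (p := (u.1 + 1, u.2)) (q := q) ?_ rfl ?_
        (by simp only; omega)
      · intro e he
        refine hadj e ?_
        rw [h12]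
        exact mem_steps_append_right he
      · rw [h12, List.getLast?_append] at hlast
        simpa using hlast
  · have hjx' : j < x.2 := by
      by_contra hcon
      exact hij ⟨x, hx, hix, by simp only; omega⟩
    obtain ⟨m, rfl⟩ : ∃ m, n = m + 1 := ⟨n - 1, by omega⟩
    obtain ⟨s₁, r, s₂, h1, hrj, hle⟩ := exists_first_passage hadj (j := j) rfl hlast hpj (by omega)
    -- A passage further right would have a point of `I` next to it that is visible from `(i, j)`.
    have hri : r.1 ≤ i := by
      obtain ⟨w, hw, hc1, hc2⟩ := hnear (r.1, r.2 + 1) (by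
        rw [hs, h1]; simp)
      obtain ⟨w', hw', hc1', hc2'⟩ := hnear r (by rw [hs, h1]; simp)
      by_contra hcon
      refine hij ⟨w', hw', ?_, ?_⟩ <;> simp only <;> omega
    have h1' : p :: s = (s₁ ++ [r]) ++ (r.1, r.2 + 1) :: s₂ := by simp [h1]
    rw [show m + 1 + 2 = (m + 2) + 1 by ring, stairWord,
      if_neg ((hH i j hi hix hj hjx).not.2 hij), h1, word_append_cons, word_cons_cons]
    have hdir : dir (r, (r.1, r.2 + 1)) = north := by simp [dir]
    rw [hdir]
    refine List.Sublist.trans ?_ (List.sublist_append_right _ _)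
    refine List.Sublist.cons_cons _ ?_
    refine ih m (by omega) i (j + 1) hi hix (by omega) (by omega) (by push_cast at hn; omega)
      (s₀ ++ (s₁ ++ [r])) _ s₂ (by rw [hs, h1']; simp) hri (by simp only; omega) ?_
    intro w hw hiw
    have hmem := hcor w hw hiw
    rw [h1', List.mem_append] at hmem
    rcases hmem with hmem | hmem
    · exfalso
      exact hij ⟨w, hw.1, hiw, by simpa using hle _ hmem⟩
    · exact hmem

/-- The staircase word of the south-east hull of `I` is a subword of the word of an arc that
contains the south-east corners. -/
theorem IsArc.stairWord_sublist {I : Set (ℤ × ℤ)} (hI : I.Finite) {a b x : ℤ × ℤ} (hx : x ∈ I)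
    (ha : IsSouthWest I a) (hb : IsNorthEast I b) (ha₁ : a.1 ≤ 0) (ha₂ : a.2 ≤ 0)
    (hx₁ : 0 ≤ x.1) (hx₂ : 0 ≤ x.2) (hxb : x.2 ≤ b.2) {l : List (ℤ × ℤ)}
    (hl : IsArc I a b l) {H : ℤ × ℤ → Prop}
    (hH : ∀ i j, 0 ≤ i → i ≤ x.1 → 0 ≤ j → j ≤ x.2 → (H (i, j) ↔ SeesSouthEast I (i, j)))
    (hH' : ∀ j, ¬ H (x.1 + 1, j))
    (hcor : ∀ u, IsSouthEast I u → 0 ≤ u.1 → (u.1 + 1, u.2) ∈ l) {n : ℕ}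
    (hn : (n : ℤ) = x.1 + x.2) :
    (stairWord H (n + 2) (0, 0)).Sublist (word l) := by
  obtain ⟨r, rfl⟩ : ∃ r, l = a :: r := by
    have := hl.head
    cases l with
    | nil => simp at this
    | cons x r => simp at this; exact ⟨r, by rw [this]⟩
  exact stairWord_sublist_aux hI hx hH hH' hl.adj hl.near hl.last (by simp only; omega)
    (fun u u' s₁ s₂ hu hu' h0 huu hs hmem =>
      hl.southEast_mem_right ha hb hu hu' (by omega) huu hs hmem)
    n 0 0 le_rfl hx₁ le_rfl hx₂ (by omega) [] a r rfl ha₁ ha₂ hcor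

/-! ### The staircase hull of a region -/

/-- The part of the rectangle with opposite corners `0` and `x` that lies between the south-east
and the north-west staircase hulls of `I`. -/
def hull (x : ℤ × ℤ) (I : Set (ℤ × ℤ)) : Set (ℤ × ℤ) :=
  {v | (0 ≤ v.1 ∧ v.1 ≤ x.1 ∧ 0 ≤ v.2 ∧ v.2 ≤ x.2) ∧ SeesSouthEast I v ∧ SeesNorthWest I v}

section Hull

variable {I : Set (ℤ × ℤ)} {x : ℤ × ℤ}

theorem SeesSouthEast.mono {v w : ℤ × ℤ} (h : SeesSouthEast I v) (h1 : w.1 ≤ v.1)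
    (h2 : v.2 ≤ w.2) : SeesSouthEast I w := by
  obtain ⟨u, hu, ha, hb⟩ := h
  exact ⟨u, hu, by omega, by omega⟩

theorem SeesNorthWest.mono {v w : ℤ × ℤ} (h : SeesNorthWest I v) (h1 : v.1 ≤ w.1)
    (h2 : w.2 ≤ v.2) : SeesNorthWest I w := by
  obtain ⟨u, hu, ha, hb⟩ := h
  exact ⟨u, hu, by omega, by omega⟩

/-- If both failed, the two quadrants would cover column `i` and empty it, separating 0 from `x` in
the connected set `I`. -/
theorem IsRegion.seesNorthWest_or_seesSouthEast (hI : IsRegion I) (h0 : (0, 0) ∈ I) (hx : x ∈ I)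
    {i j : ℤ} (hj : 1 ≤ j) (hi : 0 ≤ i) (hix : i ≤ x.1) :
    SeesNorthWest I (i, j) ∨ SeesSouthEast I (i, j - 1) := by
  by_contra! hcon
  have h1 : ∀ u ∈ I, ¬ (u.1 ≤ i ∧ j ≤ u.2) := fun u hu h => hcon.1 ⟨u, hu, h⟩
  have h2 : ∀ u ∈ I, ¬ (i ≤ u.1 ∧ u.2 ≤ j - 1) := fun u hu h => hcon.2 ⟨u, hu, h⟩
  have := hI.conn (fun u => u.1 < i) ?_ (0, 0) h0 ?_ x hx
  · omega
  · intro u hu w hw huw hui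
    have := h1 w hw
    have := h2 w hw
    have := h2 u hu
    have := adj_iff.1 huw
    omega
  · have := h2 _ h0
    simp only at this ⊢
    omega

/-- If both failed, no edge of `I` could lead from column `i - 1` to column `i`. -/
theorem IsRegion.seesSouthEast_or_seesNorthWest (hI : IsRegion I) (h0 : (0, 0) ∈ I) (hx : x ∈ I)
    {i j : ℤ} (hi : 1 ≤ i) (hix : i ≤ x.1) :
    SeesSouthEast I (i, j - 1) ∨ SeesNorthWest I (i - 1, j) := by
  by_contra! hcon
  have h1 : ∀ u ∈ I, ¬ (u.1 ≤ i - 1 ∧ j ≤ u.2) := fun u hu h => hcon.2 ⟨u, hu, h⟩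
  have h2 : ∀ u ∈ I, ¬ (i ≤ u.1 ∧ u.2 ≤ j - 1) := fun u hu h => hcon.1 ⟨u, hu, h⟩
  have := hI.conn (fun u => u.1 < i) ?_ (0, 0) h0 (by simp only; omega) x hx
  · omega
  · intro u hu w hw huw hui
    have := h1 w hw
    have := h2 w hw
    have := h1 u hu
    have := adj_iff.1 huw
    omega

/-- Passing to the hull keeps the staircase: descend in the column until the north-west condition
holds as well; the south-east condition survives each descent. -/
theorem IsRegion.seesSouthEast_hull (hI : IsRegion I) (h0 : (0, 0) ∈ I) (hx : x ∈ I) {i j : ℤ}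
    (hi : 0 ≤ i) (hix : i ≤ x.1) (hj : 0 ≤ j) (hjx : j ≤ x.2) :
    SeesSouthEast (hull x I) (i, j) ↔ SeesSouthEast I (i, j) := by
  constructor
  · rintro ⟨u, hu, h1, h2⟩
    exact hu.2.1.mono h1 h2
  · lift j to ℕ using hj
    intro h
    induction j with
    | zero => exact ⟨(i, 0), ⟨⟨hi, hix, le_rfl, hjx⟩, h, (0, 0), h0, hi, le_rfl⟩, le_rfl, le_rfl⟩
    | succ j ih =>
      push_cast at *
      rcases hI.seesNorthWest_or_seesSouthEast h0 hx (i := i) (j := j + 1) (by omega) hi hix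
        with h1 | h1
      · exact ⟨(i, j + 1), ⟨⟨hi, hix, by simp only; omega, hjx⟩, h, h1⟩, le_rfl, le_rfl⟩
      · rw [add_sub_cancel_right] at h1
        exact (ih (by omega) h1).mono le_rfl (by simp)

theorem zero_mem_hull (h0 : (0, 0) ∈ I) (hx₁ : 0 ≤ x.1) (hx₂ : 0 ≤ x.2) :
    (0, 0) ∈ hull x I :=
  ⟨⟨le_rfl, hx₁, le_rfl, hx₂⟩, ⟨(0, 0), h0, le_rfl, le_rfl⟩, ⟨(0, 0), h0, le_rfl, le_rfl⟩⟩

theorem mem_hull_self (hx : x ∈ I) (hx₁ : 0 ≤ x.1) (hx₂ : 0 ≤ x.2) : x ∈ hull x I :=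
  ⟨⟨hx₁, le_rfl, hx₂, le_rfl⟩, ⟨x, hx, le_rfl, le_rfl⟩, ⟨x, hx, le_rfl, le_rfl⟩⟩

theorem finite_hull : (hull x I).Finite :=
  (Set.finite_Icc ((0, 0) : ℤ × ℤ) x).subset fun _ hv =>
    ⟨⟨hv.1.1, hv.1.2.2.1⟩, hv.1.2.1, hv.1.2.2.2⟩

theorem exists_bounds {S : Set ℤ} (hfin : S.Finite)
    (hconv : ∀ a ∈ S, ∀ b ∈ S, ∀ c, a ≤ c → c ≤ b → c ∈ S) :
    ∃ lo hi : ℤ, ∀ j, j ∈ S ↔ lo ≤ j ∧ j ≤ hi := by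
  rcases S.eq_empty_or_nonempty with rfl | hne
  · exact ⟨1, 0, fun j => by simp; omega⟩
  · obtain ⟨a, ha, hamin⟩ := Set.exists_min_image S id hfin hne
    obtain ⟨b, hb, hbmax⟩ := Set.exists_max_image S id hfin hne
    exact ⟨a, b, fun j => ⟨fun hj => ⟨hamin j hj, hbmax j hj⟩, fun h => hconv a ha b hb j h.1 h.2⟩⟩

theorem exists_column_bounds (x : ℤ × ℤ) (I : Set (ℤ × ℤ)) (i : ℤ) :
    ∃ lo hi : ℤ, ∀ j, (i, j) ∈ hull x I ↔ lo ≤ j ∧ j ≤ hi := by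
  refine exists_bounds (S := {j | (i, j) ∈ hull x I}) ?_ ?_
  · exact (Set.finite_Icc 0 x.2).subset fun j hj => ⟨hj.1.2.2.1, hj.1.2.2.2⟩
  · rintro a ⟨ha, ha1, ha2⟩ b ⟨hb, hb1, hb2⟩ c hac hcb
    simp only at ha hb
    exact ⟨by simp only; omega, ha1.mono le_rfl hac, hb2.mono le_rfl hcb⟩

theorem exists_row_bounds (x : ℤ × ℤ) (I : Set (ℤ × ℤ)) (j : ℤ) :
    ∃ lo hi : ℤ, ∀ i, (i, j) ∈ hull x I ↔ lo ≤ i ∧ i ≤ hi := by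
  refine exists_bounds (S := {i | (i, j) ∈ hull x I}) ?_ ?_
  · exact (Set.finite_Icc 0 x.1).subset fun j hj => ⟨hj.1.1, hj.1.2.1⟩
  · rintro a ⟨ha, ha1, ha2⟩ b ⟨hb, hb1, hb2⟩ c hac hcb
    simp only at ha hb
    exact ⟨by simp only; omega, hb1.mono hcb le_rfl, ha2.mono hac le_rfl⟩

theorem IsRegion.hull_step (hI : IsRegion I) (h0 : (0, 0) ∈ I) (hx : x ∈ I) {v : ℤ × ℤ}
    (hv : v ∈ hull x I) (hne : v ≠ (0, 0)) :
    (v.1 - 1, v.2) ∈ hull x I ∨ (v.1, v.2 - 1) ∈ hull x I := by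
  obtain ⟨i, j⟩ := v
  obtain ⟨hbox, hSE, hNW⟩ := hv
  simp only at hbox ⊢
  by_cases hi : i = 0
  · subst hi
    have hj : j ≠ 0 := fun h => hne (by rw [h])
    refine Or.inr ⟨by simp only; omega, ⟨(0, 0), h0, le_rfl, by simp only; omega⟩,
      hNW.mono le_rfl (by simp only; omega)⟩
  by_cases hj : j = 0
  · subst hj
    refine Or.inl ⟨by simp only; omega, hSE.mono (by simp only; omega) le_rfl,
      ⟨(0, 0), h0, by simp only; omega, le_rfl⟩⟩
  rcases hI.seesSouthEast_or_seesNorthWest h0 hx (i := i) (j := j) (by omega)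
    (by omega) with h | h
  · exact Or.inr ⟨by simp only; omega, h, hNW.mono le_rfl (by simp only; omega)⟩
  · exact Or.inl ⟨by simp only; omega, hSE.mono (by simp only; omega) le_rfl, h⟩

/-- Connected, since every point descends inside the hull to 0; without holes, since columns are
intervals and an outer vertex escapes vertically. -/
theorem IsRegion.isRegion_hull (hI : IsRegion I) (h0 : (0, 0) ∈ I) (hx : x ∈ I) :
    IsRegion (hull x I) := by
  refine ⟨finite_hull, ?_, ?_⟩
  · intro P hP
    have key : ∀ n : ℕ, ∀ v ∈ hull x I, v.1 + v.2 = n → (P v ↔ P (0, 0)) := by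
      intro n
      induction n with
      | zero =>
        intro v hv hn
        have : v = (0, 0) := by
          have := hv.1
          ext <;> simp at hn ⊢ <;> omega
        rw [this]
      | succ n ih =>
        intro v hv hn
        have hne : v ≠ (0, 0) := by
          rintro rfl; simp at hn; omega
        have hiff : ∀ w ∈ hull x I, squareLattice.Adj v w → (P v ↔ P w) := fun w hw h =>
          ⟨hP v hv w hw h, hP w hw v hv h.symm⟩
        push_cast at hn
        rcases hI.hull_step h0 hx hv hne with h | h
        · rw [hiff _ h (by simp [adj_iff]), ih _ h (by simp only; omega)]
        · rw [hiff _ h (by simp [adj_iff]), ih _ h (by simp only; omega)]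
    have key' : ∀ v ∈ hull x I, (P v ↔ P (0, 0)) := fun v hv => by
      obtain ⟨n, hn⟩ := Int.eq_ofNat_of_zero_le (a := v.1 + v.2) (by have := hv.1; omega)
      exact key n v hv hn
    intro u hu hPu v hv
    rw [key' v hv, ← key' u hu]
    exact hPu
  · rintro ⟨i, j⟩ hv S hvS hS
    obtain ⟨lo, hi, hlh⟩ := exists_column_bounds x I i
    rw [hlh] at hv
    have hmem : ∃ σ : ℤ, σ ≠ 0 ∧ ∀ n : ℕ, (i, j + σ * n) ∈ S := by
      rcases lt_or_ge j lo with h | h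
      · refine ⟨-1, by simp, fun n => ?_⟩
        induction n with
        | zero => simpa using hvS
        | succ n ih =>
          refine hS _ ih ?_ _ ?_ ?_
          · rw [hlh]; omega
          · rw [hlh]; push_cast; omega
          · rw [adj_iff]; push_cast; omega
      · refine ⟨1, by simp, fun n => ?_⟩
        induction n with
        | zero => simpa using hvS
        | succ n ih =>
          refine hS _ ih ?_ _ ?_ ?_
          · rw [hlh]; omega
          · rw [hlh]; push_cast; omega
          · rw [adj_iff]; push_cast; omega
    obtain ⟨σ, hσ, hmem⟩ := hmem
    refine Set.infinite_of_injective_forall_mem (f := fun n : ℕ => (i, j + σ * n)) ?_ hmem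
    intro m n hmn
    simpa [hσ] using hmn

/-- The edge boundary of the staircase hull has at most as many edges as the rectangle. -/
theorem exists_finset_hull {x₁ x₂ : ℕ} (I : Set (ℤ × ℤ)) :
    ∃ γ : Finset (Sym2 (ℤ × ℤ)), (γ : Set (Sym2 (ℤ × ℤ))) = edgeBoundary (hull (x₁, x₂) I) ∧
      γ.card ≤ minimalContourSize x₁ x₂ := by
  classical
  choose lo hi hcol using exists_column_bounds ((x₁ : ℤ), (x₂ : ℤ)) I
  choose le ri hrow using exists_row_bounds ((x₁ : ℤ), (x₂ : ℤ)) I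
  set Q := hull ((x₁ : ℤ), (x₂ : ℤ)) I
  -- Two edges for each of the x₁ + 1 columns and x₂ + 1 rows; superfluous ones for empty intervals
  -- do not hurt an upper bound.
  let F : Finset (Sym2 (ℤ × ℤ)) :=
    ((Finset.Icc (0 : ℤ) x₁).image fun i => s((i, lo i - 1), (i, lo i))) ∪
    ((Finset.Icc (0 : ℤ) x₁).image fun i => s((i, hi i), (i, hi i + 1))) ∪
    ((Finset.Icc (0 : ℤ) x₂).image fun j => s((le j - 1, j), (le j, j))) ∪
    ((Finset.Icc (0 : ℤ) x₂).image fun j => s((ri j, j), (ri j + 1, j)))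
  have hF : F.card ≤ minimalContourSize x₁ x₂ := by
    have h1 : (Finset.Icc (0 : ℤ) x₁).card = x₁ + 1 := by simp
    have h2 : (Finset.Icc (0 : ℤ) x₂).card = x₂ + 1 := by simp
    have hi1 : ∀ f : ℤ → Sym2 (ℤ × ℤ), ((Finset.Icc (0 : ℤ) x₁).image f).card ≤ x₁ + 1 :=
      fun f => h1 ▸ Finset.card_image_le
    have hi2 : ∀ f : ℤ → Sym2 (ℤ × ℤ), ((Finset.Icc (0 : ℤ) x₂).image f).card ≤ x₂ + 1 :=
      fun f => h2 ▸ Finset.card_image_le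
    refine (Finset.card_union_le _ _).trans ?_
    refine (Nat.add_le_add_right (Finset.card_union_le _ _) _).trans ?_
    refine (Nat.add_le_add_right (Nat.add_le_add_right (Finset.card_union_le _ _) _) _).trans ?_
    have := hi1 fun i => s((i, lo i - 1), (i, lo i))
    have := hi1 fun i => s((i, hi i), (i, hi i + 1))
    have := hi2 fun j => s((le j - 1, j), (le j, j))
    have := hi2 fun j => s((ri j, j), (ri j + 1, j))
    unfold minimalContourSize
    omega
  have hsub : edgeBoundary Q ⊆ F := by
    rintro _ ⟨⟨i, j⟩, hu, ⟨i', j'⟩, hv, huv, rfl⟩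
    have hbox := hu.1
    simp only at hbox
    simp only [F, Finset.coe_union, Finset.coe_image, Set.mem_union, Set.mem_image,
      Finset.mem_coe, Finset.mem_Icc]
    rcases adj_iff.1 huv with ⟨h1, h2⟩ | ⟨h1, h2⟩ | ⟨h1, h2⟩ | ⟨h1, h2⟩ <;> simp only at h1 h2 <;>
      subst h1 h2
    · right
      rw [hrow] at hu hv
      exact ⟨j', by omega, by rw [show ri j' = i by omega]⟩
    · left; right
      rw [hrow] at hu hv
      exact ⟨j', by omega, by rw [show le j' = i by omega, Sym2.eq_swap]⟩
    · left; left; right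
      rw [hcol] at hu hv
      exact ⟨i', by omega, by rw [show hi i' = j by omega]⟩
    · left; left; left
      rw [hcol] at hu hv
      exact ⟨i', by omega, by rw [show lo i' = j by omega, Sym2.eq_swap]⟩
  have hfin : (edgeBoundary Q).Finite := F.finite_toSet.subset hsub
  refine ⟨hfin.toFinset, hfin.coe_toFinset, ?_⟩
  refine (Finset.card_le_card fun e he => ?_).trans hF
  exact hsub (hfin.mem_toFinset.1 he)

end Hull

/-! ### Reflection in the diagonal -/

/-- The reflection of a set of vertices in the diagonal. -/
def reflect (I : Set (ℤ × ℤ)) : Set (ℤ × ℤ) := Prod.swap ⁻¹' I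

section Reflect

variable {I : Set (ℤ × ℤ)}

theorem adj_swap {p q : ℤ × ℤ} :
    squareLattice.Adj p.swap q.swap ↔ squareLattice.Adj p q := by
  simp only [adj_iff, Prod.fst_swap, Prod.snd_swap]; omega

theorem IsRegion.reflect (hI : IsRegion I) : IsRegion (reflect I) := by
  refine ⟨hI.finite.preimage Prod.swap_injective.injOn, ?_, ?_⟩
  · intro P hP u hu hPu v hv
    have := hI.conn (fun w => P w.swap) (fun a ha b hb hab => hP a.swap (by
      simpa [LatticeContour.reflect] using ha) b.swap (by
      simpa [LatticeContour.reflect] using hb) (adj_swap.2 hab)) u.swap hu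
      (by simpa using hPu) v.swap hv
    simpa using this
  · intro v hv S hvS hS hfin
    refine hI.infinite_of_notMem v.swap hv (Prod.swap ⁻¹' S) (by simpa using hvS) ?_
      (hfin.preimage Prod.swap_injective.injOn)
    intro u hu huI w hwI huw
    exact hS _ hu (by simpa [LatticeContour.reflect] using huI) _
      (by simpa [LatticeContour.reflect] using hwI) (adj_swap.2 huw)

theorem seesSouthEast_reflect {v : ℤ × ℤ} :
    SeesSouthEast (reflect I) v ↔ SeesNorthWest I v.swap := by
  constructor
  · rintro ⟨u, hu, h1, h2⟩
    exact ⟨u.swap, hu, h2, h1⟩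
  · rintro ⟨u, hu, h1, h2⟩
    exact ⟨u.swap, by simpa [reflect] using hu, h2, h1⟩

theorem seesNorthWest_reflect {v : ℤ × ℤ} :
    SeesNorthWest (reflect I) v ↔ SeesSouthEast I v.swap := by
  constructor
  · rintro ⟨u, hu, h1, h2⟩
    exact ⟨u.swap, hu, h2, h1⟩
  · rintro ⟨u, hu, h1, h2⟩
    exact ⟨u.swap, by simpa [reflect] using hu, h2, h1⟩

/-- Reflection lets the north-west half of every argument follow from the south-east half. -/
theorem hull_reflect (x : ℤ × ℤ) : hull x.swap (reflect I) = reflect (hull x I) := by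
  ext v
  simp only [hull, reflect, Set.mem_preimage, Set.mem_ofPred_eq, Prod.fst_swap, Prod.snd_swap]
  rw [← reflect, seesSouthEast_reflect, seesNorthWest_reflect]
  tauto

theorem isSouthEast_reflect {u : ℤ × ℤ} :
    IsSouthEast (reflect I) u ↔ IsNorthWest I u.swap := by
  constructor
  · rintro ⟨hu, h⟩
    refine ⟨hu, fun w hw h1 h2 => ?_⟩
    rw [← h w.swap (by simpa [reflect] using hw) h2 h1, Prod.swap_swap]
  · rintro ⟨hu, h⟩
    refine ⟨hu, fun w hw h1 h2 => ?_⟩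
    exact Prod.swap_injective (h w.swap hw h2 h1)

theorem IsSouthWest.reflect {u : ℤ × ℤ} (h : IsSouthWest I u) :
    IsSouthWest (reflect I) u.swap := by
  refine ⟨by simpa [LatticeContour.reflect] using h.1, fun w hw h1 h2 => ?_⟩
  rw [← h.2 w.swap hw h2 h1, Prod.swap_swap]

theorem IsNorthEast.reflect {u : ℤ × ℤ} (h : IsNorthEast I u) :
    IsNorthEast (reflect I) u.swap := by
  refine ⟨by simpa [LatticeContour.reflect] using h.1, fun w hw h1 h2 => ?_⟩
  rw [← h.2 w.swap hw h2 h1, Prod.swap_swap]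

theorem IsArc.reflect {a b : ℤ × ℤ} {l : List (ℤ × ℤ)} (h : IsArc I a b l) :
    IsArc (reflect I) a.swap b.swap (l.map Prod.swap) := by
  refine ⟨h.nodup.map Prod.swap_injective, ?_, ?_, ?_, ?_⟩
  · intro e he
    rw [steps_map, List.mem_map] at he
    obtain ⟨f, hf, rfl⟩ := he
    exact adj_swap.2 (h.adj f hf)
  · intro p hp
    obtain ⟨q, hq, rfl⟩ := List.mem_map.1 hp
    obtain ⟨u, hu, h1, h2⟩ := h.near q hq
    exact ⟨u.swap, by simpa [LatticeContour.reflect] using hu, h2, h1⟩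
  · rw [List.head?_map, h.head]; rfl
  · rw [List.getLast?_map, h.last]; rfl

end Reflect

/-! ### Splitting the boundary cycle -/

section Cycle

variable {I : Set (ℤ × ℤ)} {z : ℤ × ℤ} {t : List (ℤ × ℤ)}

theorem IsBoundaryCycle.reverse (h : IsBoundaryCycle I z t) : IsBoundaryCycle I z t.reverse := by
  refine ⟨?_, by simpa using h.two_le, ?_⟩
  · have := h.nodup
    simpa using this
  · have : z :: (t.reverse ++ [z]) = (z :: (t ++ [z])).reverse := by simp
    rw [this, steps_reverse]
    intro e he
    simp only [List.mem_reverse, List.mem_map] at he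
    obtain ⟨f, hf, rfl⟩ := he
    exact (h.step f hf).symm

theorem IsBoundaryCycle.mem_of_cross (h : IsBoundaryCycle I z t) (hI : IsRegion I) {p q : ℤ × ℤ}
    (hpq : BoundaryStep I p q) : p ∈ z :: t ∧ q ∈ z :: t := by
  obtain ⟨e, he, hcr⟩ := h.exists_cross_eq hI hpq.2
  have hmem : ∀ x ∈ z :: (t ++ [z]), x ∈ z :: t := by
    intro x hx; simp at hx ⊢; tauto
  have h1 := hmem _ (fst_mem_of_mem_steps he)
  have h2 := hmem _ (snd_mem_of_mem_steps he)
  rcases cross_injective (e := (p, q)) hpq.1 (h.step e he).1 hcr.symm with rfl | rfl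
  · exact ⟨h1, h2⟩
  · exact ⟨h2, h1⟩

theorem IsBoundaryCycle.corner_mem_right (h : IsBoundaryCycle I z t) (hI : IsRegion I) {u : ℤ × ℤ}
    (hu : u ∈ I) (hr : (u.1 + 1, u.2) ∉ I) :
    (u.1 + 1, u.2) ∈ z :: t ∧ (u.1 + 1, u.2 + 1) ∈ z :: t := by
  refine h.mem_of_cross hI (boundaryStep_up.2 ?_)
  rw [add_sub_cancel_right]
  tauto

theorem IsBoundaryCycle.corner_mem_left (h : IsBoundaryCycle I z t) (hI : IsRegion I) {u : ℤ × ℤ}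
    (hu : u ∈ I) (hr : (u.1 - 1, u.2) ∉ I) : u ∈ z :: t ∧ (u.1, u.2 + 1) ∈ z :: t := by
  refine h.mem_of_cross hI (boundaryStep_up (a := u.1) (b := u.2).2 ?_)
  tauto

theorem IsBoundaryCycle.southEast_mem (h : IsBoundaryCycle I z t) (hI : IsRegion I) {u : ℤ × ℤ}
    (hu : IsSouthEast I u) : (u.1 + 1, u.2) ∈ z :: t := by
  refine (h.corner_mem_right hI hu.1 fun hr => ?_).1
  have := congrArg Prod.fst (hu.2 _ hr (by simp) le_rfl)
  simp at this

theorem IsBoundaryCycle.northEast_mem (h : IsBoundaryCycle I z t) (hI : IsRegion I) {u : ℤ × ℤ}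
    (hu : IsNorthEast I u) : (u.1 + 1, u.2 + 1) ∈ z :: t := by
  refine (h.corner_mem_right hI hu.1 fun hr => ?_).2
  have := congrArg Prod.fst (hu.2 _ hr (by simp) le_rfl)
  simp at this

theorem IsBoundaryCycle.southWest_mem (h : IsBoundaryCycle I z t) (hI : IsRegion I) {u : ℤ × ℤ}
    (hu : IsSouthWest I u) : u ∈ z :: t := by
  refine (h.corner_mem_left hI hu.1 fun hr => ?_).1
  have := congrArg Prod.fst (hu.2 _ hr (by simp) le_rfl)
  simp at this

theorem IsBoundaryCycle.northWest_mem (h : IsBoundaryCycle I z t) (hI : IsRegion I) {u : ℤ × ℤ}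
    (hu : IsNorthWest I u) : (u.1, u.2 + 1) ∈ z :: t := by
  refine (h.corner_mem_left hI hu.1 fun hr => ?_).2
  have := congrArg Prod.fst (hu.2 _ hr (by simp) le_rfl)
  simp at this

theorem exists_isSouthWest (hI : I.Finite) {v : ℤ × ℤ} (hv : v ∈ I) :
    ∃ u, IsSouthWest I u ∧ u.1 ≤ v.1 ∧ u.2 ≤ v.2 := by
  obtain ⟨u, ⟨hu, hu1, hu2⟩, hmin⟩ := Set.exists_min_image {w | w ∈ I ∧ w.1 ≤ v.1 ∧ w.2 ≤ v.2}
    (fun w => w.1 + w.2) (hI.subset fun x hx => hx.1) ⟨v, hv, le_rfl, le_rfl⟩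
  refine ⟨u, ⟨hu, fun w hw h1 h2 => ?_⟩, hu1, hu2⟩
  have := hmin w ⟨hw, by omega, by omega⟩
  ext <;> omega

theorem exists_isNorthEast (hI : I.Finite) {v : ℤ × ℤ} (hv : v ∈ I) :
    ∃ u, IsNorthEast I u ∧ v.1 ≤ u.1 ∧ v.2 ≤ u.2 := by
  obtain ⟨u, ⟨hu, hu1, hu2⟩, hmax⟩ := Set.exists_max_image {w | w ∈ I ∧ v.1 ≤ w.1 ∧ v.2 ≤ w.2}
    (fun w => w.1 + w.2) (hI.subset fun x hx => hx.1) ⟨v, hv, le_rfl, le_rfl⟩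
  refine ⟨u, ⟨hu, fun w hw h1 h2 => ?_⟩, hu1, hu2⟩
  have := hmax w ⟨hw, by omega, by omega⟩
  ext <;> omega

theorem exists_boundaryStep (hI : I.Finite) (hne : I.Nonempty) :
    ∃ p q, BoundaryStep I p q := by
  obtain ⟨v, hv⟩ := hne
  obtain ⟨u, hu, -, -⟩ := exists_isNorthEast hI hv
  refine ⟨_, _, boundaryStep_up (a := u.1 + 1) (b := u.2).2 ?_⟩
  have h1 : (u.1 + 1, u.2) ∉ I := fun hr => by
    have := congrArg Prod.fst (hu.2 _ hr (by simp) le_rfl)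
    simp at this
  rw [add_sub_cancel_right]
  have h2 : (u.1, u.2) ∈ I := hu.1
  tauto

/-- The two arcs into which a boundary cycle is split by two of its points. -/
theorem IsBoundaryCycle.isArc {a b : ℤ × ℤ} {l₁ l₂ : List (ℤ × ℤ)}
    (h : IsBoundaryCycle I a (l₁ ++ (b.1 + 1, b.2 + 1) :: l₂)) :
    IsArc I a b (a :: (l₁ ++ [(b.1 + 1, b.2 + 1)])) := by
  set b' : ℤ × ℤ := (b.1 + 1, b.2 + 1)
  have hsplit : a :: (l₁ ++ b' :: l₂ ++ [a]) = (a :: (l₁ ++ [b'])) ++ (l₂ ++ [a]) := by simp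
  have hstep : ∀ e ∈ steps (a :: (l₁ ++ [b'])), BoundaryStep I e.1 e.2 := fun e he =>
    h.step e (hsplit ▸ mem_steps_append_left he)
  refine ⟨?_, fun e he => (hstep e he).1, ?_, rfl, getLast?_cons_concat _ _ _⟩
  · have := h.nodup
    have h2 : a :: (l₁ ++ b' :: l₂) = (a :: (l₁ ++ [b'])) ++ l₂ := by simp
    rw [h2] at this
    exact this.of_append_left
  · obtain ⟨c, r, hcr⟩ := exists_concat_eq_cons l₁ b'
    intro p hp
    rcases List.mem_cons.1 hp with rfl | hp'
    · exact (hstep (p, c) (by rw [hcr]; simp)).exists_isCornerOf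
    · have hp2 : p ∈ (steps (a :: (l₁ ++ [b']))).map Prod.snd := by
        rw [steps, List.map_snd_zip (by simp)]; exact hp'
      obtain ⟨e, he, rfl⟩ := List.mem_map.1 hp2
      exact (hstep e he).symm.exists_isCornerOf

/-- The boundary of a region splits into two arcs, one through all relevant south-east corners
and one through all relevant north-west corners. -/
theorem IsRegion.exists_arcs (hI : IsRegion I) (h0 : (0, 0) ∈ I) {x : ℤ × ℤ} (hx : x ∈ I)
    (hx₁ : 0 ≤ x.1) :
    ∃ (a b : ℤ × ℤ) (l₁ l₂ : List (ℤ × ℤ)), IsSouthWest I a ∧ IsNorthEast I b ∧ a.1 ≤ 0 ∧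
      a.2 ≤ 0 ∧ x.1 ≤ b.1 ∧ x.2 ≤ b.2 ∧
      IsBoundaryCycle I a (l₁ ++ (b.1 + 1, b.2 + 1) :: l₂) ∧
      IsArc I a b (a :: (l₁ ++ [(b.1 + 1, b.2 + 1)])) ∧
      IsArc I a b (a :: (l₂.reverse ++ [(b.1 + 1, b.2 + 1)])) ∧
      (∀ u, IsSouthEast I u → 0 ≤ u.1 →
        (u.1 + 1, u.2) ∈ a :: (l₁ ++ [(b.1 + 1, b.2 + 1)])) ∧
      (∀ w, IsNorthWest I w → 0 ≤ w.2 →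
        (w.1, w.2 + 1) ∈ a :: (l₂.reverse ++ [(b.1 + 1, b.2 + 1)])) := by
  obtain ⟨a, ha, ha₁, ha₂⟩ := exists_isSouthWest hI.finite h0
  obtain ⟨b, hb, hb₁, hb₂⟩ := exists_isNorthEast hI.finite hx
  simp only at ha₁ ha₂
  obtain ⟨p, q, hpq⟩ := exists_boundaryStep hI.finite ⟨_, h0⟩
  obtain ⟨z, t, hz⟩ := exists_isBoundaryCycle hI.finite hpq
  obtain ⟨t, ht⟩ := hz.rotate (hz.southWest_mem hI ha)
  -- A reference corner. Reversing the cycle if necessary puts it on the first arc, and all other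
  -- corners are compared with it.
  obtain ⟨u₀, hu₀, hu₀0, -⟩ :=
    SeesSouthEast.exists_isSouthEast (i := 0) (j := 0) hI.finite ⟨_, h0, le_rfl, le_rfl⟩
  have hcyc : ∃ l₁ l₂, IsBoundaryCycle I a (l₁ ++ (b.1 + 1, b.2 + 1) :: l₂) ∧
      (u₀.1 + 1, u₀.2) ∈ l₁ := by
    have hbt : (b.1 + 1, b.2 + 1) ∈ t := by
      rcases List.mem_cons.1 (ht.northEast_mem hI hb) with h | h
      · have := congrArg Prod.fst h; simp only at this; omega
      · exact h
    have hut : (u₀.1 + 1, u₀.2) ∈ t := by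
      rcases List.mem_cons.1 (ht.southEast_mem hI hu₀) with h | h
      · have := congrArg Prod.fst h; simp only at this; omega
      · exact h
    obtain ⟨l₁, l₂, rfl⟩ := List.append_of_mem hbt
    rw [List.mem_append, List.mem_cons] at hut
    rcases hut with h | h | h
    · exact ⟨l₁, l₂, ht, h⟩
    · exact absurd h (hb.ne_southEast hu₀)
    · exact ⟨l₂.reverse, l₁.reverse, by simpa using ht.reverse, by simpa using h⟩
  obtain ⟨l₁, l₂, hc, hu₀l⟩ := hcyc
  have hA := hc.isArc
  have hB : IsArc I a b (a :: (l₂.reverse ++ [(b.1 + 1, b.2 + 1)])) := by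
    refine IsBoundaryCycle.isArc (l₂ := l₁.reverse) ?_
    simpa using hc.reverse
  have hnd := hc.nodup
  have hdisj : ∀ p ∈ a :: (l₁ ++ [(b.1 + 1, b.2 + 1)]),
      p ∈ a :: (l₂.reverse ++ [(b.1 + 1, b.2 + 1)]) → p = a ∨ p = (b.1 + 1, b.2 + 1) := by
    intro p hp hp'
    simp only [List.mem_cons, List.mem_append, List.mem_reverse, List.not_mem_nil, or_false]
      at hp hp'
    have hd := List.disjoint_of_nodup_append (List.nodup_cons.1 hnd).2
    have : p ∈ l₁ → p ∈ l₂ → False := fun h1 h2 => hd h1 (List.mem_cons_of_mem _ h2)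
    tauto
  have hcover : ∀ p ∈ a :: (l₁ ++ (b.1 + 1, b.2 + 1) :: l₂),
      p ∈ a :: (l₁ ++ [(b.1 + 1, b.2 + 1)]) ∨
      p ∈ a :: (l₂.reverse ++ [(b.1 + 1, b.2 + 1)]) := by
    intro p hp
    simp only [List.mem_cons, List.mem_append, List.mem_reverse, List.not_mem_nil, or_false]
      at hp ⊢
    tauto
  have hu₀' : (u₀.1 + 1, u₀.2) ∈ a :: (l₁ ++ [(b.1 + 1, b.2 + 1)]) := by simp [hu₀l]
  refine ⟨a, b, l₁, l₂, ha, hb, ha₁, ha₂, hb₁, hb₂, hc, hA, hB, ?_, ?_⟩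
  · intro u hu hu0
    rcases hcover _ (hc.southEast_mem hI hu) with h | h
    · exact h
    · rcases lt_trichotomy u.1 u₀.1 with hlt | heq | hgt
      · exact (hA.false_of_mem_of_mem hB hdisj ha hb hu₀ hu (by omega) hlt hu₀' h).elim
      · have : u = u₀ := by
          rcases le_total u.2 u₀.2 with hle | hle
          · exact hu₀.2 u hu.1 heq.ge hle
          · exact (hu.2 u₀ hu₀.1 heq.le hle).symm
        rwa [this]
      · exact (hB.false_of_mem_of_mem hA (fun p h1 h2 => hdisj p h2 h1) ha hb hu hu₀
          (by omega) hgt h hu₀').elim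
  · intro w hw hw0
    rcases hcover _ (hc.northWest_mem hI hw) with h | h
    · exact (hA.false_of_southEast_northWest hB hdisj ha hb hu₀ hw (by omega) (by omega)
        hu₀' h).elim
    · exact h

end Cycle

/-! ### Words of contours -/

/-- The direction of a reflected step. -/
def reflectDir (d : Dir) : Dir := (!d.1, d.2)

/-- The direction of a reversed step. -/
def reverseDir (d : Dir) : Dir := (d.1, !d.2)

theorem dir_map_swap {e : (ℤ × ℤ) × (ℤ × ℤ)} (he : squareLattice.Adj e.1 e.2) :
    dir (Prod.map Prod.swap Prod.swap e) = reflectDir (dir e) := by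
  obtain ⟨a, b, rfl | rfl | rfl | rfl⟩ := step_cases he <;> simp [dir, reflectDir]

theorem dir_swap {e : (ℤ × ℤ) × (ℤ × ℤ)} (he : squareLattice.Adj e.1 e.2) :
    dir e.swap = reverseDir (dir e) := by
  obtain ⟨a, b, rfl | rfl | rfl | rfl⟩ := step_cases he <;> simp [dir, reverseDir]

theorem word_map_swap {l : List (ℤ × ℤ)} (hl : ∀ e ∈ steps l, squareLattice.Adj e.1 e.2) :
    word (l.map Prod.swap) = (word l).map reflectDir := by
  rw [word, word, steps_map, List.map_map, List.map_map]
  exact List.map_congr_left fun e he => dir_map_swap (hl e he)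

theorem word_reverse {l : List (ℤ × ℤ)} (hl : ∀ e ∈ steps l, squareLattice.Adj e.1 e.2) :
    word l.reverse = ((word l).map reverseDir).reverse := by
  rw [word, word, steps_reverse, List.map_reverse, List.map_map, List.map_map]
  congr 1
  exact List.map_congr_left fun e he => dir_swap (hl e he)

/-- The closed staircase word around the set `Q`. -/
noncomputable def hullWord (n : ℕ) (Q : Set (ℤ × ℤ)) : List Dir :=
  stairWord (SeesSouthEast Q) n (0, 0) ++
    (((stairWord (SeesSouthEast (reflect Q)) n (0, 0)).map reflectDir).map reverseDir).reverse

theorem length_hullWord (n : ℕ) (Q : Set (ℤ × ℤ)) : (hullWord n Q).length = 2 * n := by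
  simp [hullWord, length_stairWord]; ring

theorem reflectDir_reflectDir (d : Dir) : reflectDir (reflectDir d) = d := by
  simp [reflectDir]

/-- The boundary of a region that contains `0` and `x` is traversed by a closed path whose word
contains the staircase word of its hull. -/
theorem IsRegion.exists_closed_path {I : Set (ℤ × ℤ)} (hI : IsRegion I) (h0 : (0, 0) ∈ I)
    {x₁ x₂ : ℕ} (hx : ((x₁ : ℤ), (x₂ : ℤ)) ∈ I) :
    ∃ (a : ℤ × ℤ) (l : List (ℤ × ℤ)), a.1 ≤ 0 ∧ a.2 ≤ 0 ∧ l.head? = some a ∧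
      (∀ e ∈ steps l, squareLattice.Adj e.1 e.2) ∧
      (∀ f, f ∈ edgeBoundary I ↔ f ∈ (steps l).map cross) ∧ ((steps l).map cross).Nodup ∧
      minimalContourSize x₁ x₂ + 2 * (-a.1 - a.2) ≤ (word l).length ∧
      (hullWord (x₁ + x₂ + 2) (hull (x₁, x₂) I)).Sublist (word l) := by
  obtain ⟨a, b, l₁, l₂, ha, hb, ha₁, ha₂, hb₁, hb₂, hc, hL, hU, hSE, hNW⟩ :=
    hI.exists_arcs h0 hx (by simp)
  simp only at hb₁ hb₂
  set b' : ℤ × ℤ := (b.1 + 1, b.2 + 1) with hb'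
  have hUrev : b' :: (l₂ ++ [a]) = (a :: (l₂.reverse ++ [b'])).reverse := by simp
  have hword : word (a :: (l₁ ++ b' :: l₂ ++ [a])) =
      word (a :: (l₁ ++ [b'])) ++ word (a :: (l₂.reverse ++ [b'])).reverse := by
    have : a :: (l₁ ++ b' :: l₂ ++ [a]) = (a :: l₁) ++ b' :: (l₂ ++ [a]) := by simp
    rw [this, word_append_cons, hUrev, List.cons_append]
  refine ⟨a, a :: (l₁ ++ b' :: l₂ ++ [a]), ha₁, ha₂, rfl, fun e he => (hc.step e he).1, ?_,
    hc.nodup_cross, ?_, ?_⟩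
  · intro f
    rw [List.mem_map]
    exact ⟨fun hf => hc.exists_cross_eq hI hf, fun ⟨e, he, hf⟩ => hf ▸ (hc.step e he).2⟩
  -- Each arc is at least as long as the ℓ¹ distance of its ends, so a starting point away from 0
  -- costs surplus edges twice.
  · have h1 := le_length_of_adj hL.adj hL.head hL.last
    have h2 := le_length_of_adj hU.adj hU.head hU.last
    rw [hword, List.length_append, length_word, length_word, List.length_reverse]
    unfold minimalContourSize
    simp only [List.length_cons] at h1 h2 ⊢
    push_cast at h1 h2 ⊢
    omega
  · rw [hword, hullWord, word_reverse hU.adj]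
    refine List.Sublist.append ?_ (List.Sublist.reverse (List.Sublist.map _ ?_))
    · refine hL.stairWord_sublist hI.finite hx ha hb ha₁ ha₂ (by simp) (by simp) hb₂ ?_ ?_ hSE
        (by push_cast; ring)
      · intro i j hi hix hj hjx
        exact hI.seesSouthEast_hull h0 hx hi hix hj hjx
      · rintro j ⟨u, hu, h1, -⟩
        have := hu.1.2.1
        simp only at h1 this
        omega
    · have hU' := hU.reflect
      have key := hU'.stairWord_sublist (x := ((x₂ : ℤ), (x₁ : ℤ))) (n := x₁ + x₂)
        (H := SeesSouthEast (LatticeContour.reflect (hull (x₁, x₂) I))) hI.reflect.finite hx ha.reflect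
        hb.reflect ha₂ ha₁ (by simp) (by simp) hb₁ ?_ ?_ ?_ (by push_cast; ring)
      · rw [word_map_swap hU.adj] at key
        have key' := key.map reflectDir
        rw [List.map_map (f := reflectDir)] at key'
        rwa [show reflectDir ∘ reflectDir = id from funext reflectDir_reflectDir,
          List.map_id] at key'
      · intro i j hi hix hj hjx
        rw [← hull_reflect]
        exact hI.reflect.seesSouthEast_hull h0 hx hi hix hj hjx
      · rintro j ⟨u, hu, h1, -⟩
        have := hu.1.2.2.2
        simp only [Prod.snd_swap] at h1 this
        omega
      · intro u hu hu0
        have := hNW u.swap (isSouthEast_reflect.1 hu) hu0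
        exact List.mem_map.2 ⟨_, this, rfl⟩

/-! ### Counting words -/

section Superwords

variable {α : Type*} [Fintype α] [DecidableEq α]

/-- The words of length `n` that contain a given word as a subword. -/
def superwords : List α → ℕ → Finset (List α)
  | [], 0 => {[]}
  | _ :: _, 0 => ∅
  | [], n + 1 => Finset.univ.biUnion fun d => (superwords [] n).image (d :: ·)
  | b :: w, n + 1 => (superwords w n).image (b :: ·) ∪
      (Finset.univ.erase b).biUnion fun d => (superwords (b :: w) n).image (d :: ·)

/-- The recursion follows the greedy embedding, which matches each letter at its first occurrence.
-/
theorem mem_superwords {w₀ w : List α} (h : w₀.Sublist w) : w ∈ superwords w₀ w.length := by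
  induction w generalizing w₀ with
  | nil => obtain rfl := List.sublist_nil.1 h; simp [superwords]
  | cons d w ih =>
    cases w₀ with
    | nil => simpa [superwords] using ih (List.nil_sublist w)
    | cons b w₀ =>
      rw [List.length_cons, superwords, Finset.mem_union]
      by_cases hd : d = b
      · subst hd
        exact Or.inl (Finset.mem_image_of_mem _ (ih (List.cons_sublist_cons.1 h)))
      · refine Or.inr (Finset.mem_biUnion.2 ⟨d, by simp [hd],
          Finset.mem_image_of_mem _ (ih ?_)⟩)
        cases h with
        | cons _ h => exact h
        | cons_cons _ h => exact absurd rfl hd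

theorem sum_range_choose_succ (n k c : ℕ) :
    ∑ i ∈ Finset.range (k + 1), (n + 1).choose i * c ^ i =
      ∑ i ∈ Finset.range (k + 1), n.choose i * c ^ i +
        c * ∑ i ∈ Finset.range k, n.choose i * c ^ i := by
  rw [Finset.sum_range_succ', Finset.sum_range_succ' _ k, Finset.mul_sum, add_right_comm,
    ← Finset.sum_add_distrib]
  simp only [Nat.choose_zero_right]
  congr 1
  refine Finset.sum_congr rfl fun i _ => ?_
  rw [Nat.choose_succ_succ]
  ring

/-- The greedy recursion depends only on the length of `w` and matches Pascal's rule. The truncated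
subtraction gives an empty sum when `w` is too long. -/
theorem card_superwords_le {c : ℕ} (hc : Fintype.card α = c + 1) (w : List α) (n : ℕ) :
    (superwords w n).card ≤ ∑ i ∈ Finset.range (n + 1 - w.length), n.choose i * c ^ i := by
  induction n generalizing w with
  | zero =>
    cases w with
    | nil => simp [superwords]
    | cons b w => simp [superwords]
  | succ n ih =>
    cases w with
    | nil =>
      rw [superwords]
      refine (Finset.card_biUnion_le_card_mul _ _ _ fun d _ =>
        Finset.card_image_le.trans (ih [])).trans ?_
      have key : ∀ m : ℕ, ∑ i ∈ Finset.range (m + 1), m.choose i * c ^ i = (c + 1) ^ m := by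
        intro m
        rw [add_pow]
        exact Finset.sum_congr rfl fun i _ => by simp; ring
      simp only [List.length_nil, Nat.sub_zero, Finset.card_univ, hc, key]
      rw [pow_succ, mul_comm]
    | cons b w =>
      rw [superwords]
      refine (Finset.card_union_le _ _).trans ?_
      have h1 : ((superwords w n).image (b :: ·)).card ≤ _ := Finset.card_image_le.trans (ih w)
      have h2 : ((Finset.univ.erase b).biUnion fun d =>
          (superwords (b :: w) n).image (d :: ·)).card ≤ _ :=
        Finset.card_biUnion_le_card_mul _ _ _ fun d _ =>
          Finset.card_image_le.trans (ih (b :: w))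
      rw [Finset.card_erase_of_mem (Finset.mem_univ b), Finset.card_univ, hc,
        Nat.add_sub_cancel] at h2
      refine (Nat.add_le_add h1 h2).trans ?_
      rw [List.length_cons]
      rcases le_or_gt w.length n with hle | hlt
      · obtain ⟨k, rfl⟩ := Nat.exists_eq_add_of_le hle
        rw [show w.length + k + 1 - w.length = k + 1 by omega,
          show w.length + k + 1 - (w.length + 1) = k by omega,
          show w.length + k + 1 + 1 - (w.length + 1) = k + 1 by omega, sum_range_choose_succ]
      · rw [show n + 1 - w.length = 0 by omega, show n + 1 - (w.length + 1) = 0 by omega]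
        simp

end Superwords

/-! ### Numerical estimates for the constant 12 -/

/-- In this range C(n, i) at least doubles with i, so the terms grow by a factor of at least 6, and
the geometric sum is at most 6/5 of its last term. -/
theorem sum_range_choose_le {n m : ℕ} (h : 3 * m ≤ n) :
    5 * ∑ i ∈ Finset.range (m + 1), n.choose i * 3 ^ i ≤ 6 * (3 ^ m * n.choose m) := by
  induction m with
  | zero => simp
  | succ m ih =>
    rw [Finset.sum_range_succ, mul_add]
    have h1 := ih (by omega)
    have h2 : 2 * n.choose m ≤ n.choose (m + 1) := by
      have h3 := Nat.choose_succ_right_eq n m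
      have h4 : n.choose m * (2 * (m + 1)) ≤ n.choose m * (n - m) :=
        Nat.mul_le_mul_left _ (by omega)
      refine Nat.le_of_mul_le_mul_right (c := m + 1) ?_ (by omega)
      rw [h3]; linarith
    have h5 : 3 ^ m * (2 * n.choose m) ≤ 3 ^ m * n.choose (m + 1) := Nat.mul_le_mul_left _ h2
    rw [pow_succ]
    linarith

/-- Vandermonde's identity, with C(n, j) ≤ C(n, m) for j ≤ m ≤ n/2. -/
theorem choose_add_le {n m : ℕ} (h : 2 * m ≤ n) : (n + m).choose m ≤ 2 ^ m * n.choose m := by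
  have hmono : ∀ d j, j + d ≤ m → n.choose j ≤ n.choose (j + d) := by
    intro d
    induction d with
    | zero => intro j _; exact le_rfl
    | succ d ih =>
      intro j hj
      exact (ih j (by omega)).trans (Nat.choose_le_succ_of_lt_half_left (by omega))
  rw [Nat.add_choose_eq, ← Nat.sum_range_choose, Finset.sum_mul,
    Finset.Nat.sum_antidiagonal_eq_sum_range_succ (fun i j => n.choose i * m.choose j)]
  refine Finset.sum_le_sum fun j hj => ?_
  have hjm : j ≤ m := by simpa [Nat.lt_succ_iff] using hj
  rw [Nat.choose_symm hjm, mul_comm]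
  refine Nat.mul_le_mul_left _ ?_
  have := hmono (m - j) j (by omega)
  rwa [Nat.add_sub_cancel' hjm] at this

/-- The factor 5/6 is there to absorb the 6/5 of `sum_range_choose_le`; it is what fails for m = 0.
-/
theorem sum_range_succ_le {m : ℕ} (hm : 1 ≤ m) :
    6 * ∑ j ∈ Finset.range (m / 2 + 1), (j + 1) ≤ 5 * 2 ^ m := by
  -- The second conjunct bounds the increment of the first: 15 · 4^(k+1) = 5 · 4^(k+2) - 5 ·
  -- 4^(k+1).
  have key : ∀ k : ℕ, 6 * ∑ j ∈ Finset.range (k + 1 + 1), (j + 1) ≤ 5 * 4 ^ (k + 1) ∧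
      6 * (k + 3) ≤ 15 * 4 ^ (k + 1) := by
    intro k
    induction k with
    | zero => decide
    | succ k ih =>
      obtain ⟨h1, h2⟩ := ih
      have h3 := Finset.sum_range_succ (fun j => j + 1) (k + 1 + 1)
      rw [h3, pow_succ 4 (k + 1)]
      generalize ∑ j ∈ Finset.range (k + 1 + 1), (j + 1) = S at h1 ⊢
      omega
  rcases Nat.eq_zero_or_pos (m / 2) with h | h
  · rw [h]
    have : 2 ^ 1 ≤ 2 ^ m := Nat.pow_le_pow_right (by norm_num) hm
    simp
    omega
  · obtain ⟨k, hk⟩ := Nat.exists_eq_add_of_le' h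
    rw [hk]
    refine (key k).1.trans (Nat.mul_le_mul_left _ ?_)
    rw [show 4 = 2 ^ 2 by norm_num, ← pow_mul]
    exact Nat.pow_le_pow_right (by norm_num) (by omega)

theorem count_le {n m : ℕ} (hm : 1 ≤ m) (h : 2 * m ≤ n) :
    (∑ j ∈ Finset.range (m / 2 + 1), (j + 1)) *
      ∑ i ∈ Finset.range (m + 1), (n + m).choose i * 3 ^ i ≤ 12 ^ m * n.choose m := by
  have h1 := sum_range_succ_le hm
  have h2 := sum_range_choose_le (n := n + m) (m := m) (by omega)
  have h3 := choose_add_le h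
  set T := ∑ j ∈ Finset.range (m / 2 + 1), (j + 1)
  set S := ∑ i ∈ Finset.range (m + 1), (n + m).choose i * 3 ^ i
  have h4 : T * (5 * S) ≤ T * (6 * (3 ^ m * (2 ^ m * n.choose m))) :=
    Nat.mul_le_mul_left _ (h2.trans (by gcongr))
  have h5 : 6 * T * (3 ^ m * (2 ^ m * n.choose m)) ≤
      5 * 2 ^ m * (3 ^ m * (2 ^ m * n.choose m)) := Nat.mul_le_mul_right _ h1
  have h6 : (12 : ℕ) ^ m = 2 ^ m * (3 ^ m * 2 ^ m) := by
    rw [← mul_pow, ← mul_pow]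
    norm_num
  rw [h6]
  linarith

/-! ### Decoding words -/

/-- The endpoint of the step from `p` in direction `d`. -/
def move (p : ℤ × ℤ) (d : Dir) : ℤ × ℤ :=
  if d.1 then (p.1, if d.2 then p.2 + 1 else p.2 - 1) else (if d.2 then p.1 + 1 else p.1 - 1, p.2)

theorem move_dir {e : (ℤ × ℤ) × (ℤ × ℤ)} (he : squareLattice.Adj e.1 e.2) :
    move e.1 (dir e) = e.2 := by
  obtain ⟨a, b, rfl | rfl | rfl | rfl⟩ := step_cases he <;> simp [dir, move]

/-- The path from `p` with a given word. -/
def trace : ℤ × ℤ → List Dir → List (ℤ × ℤ)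
  | p, [] => [p]
  | p, d :: w => p :: trace (move p d) w

theorem trace_word {l : List (ℤ × ℤ)} (hl : ∀ e ∈ steps l, squareLattice.Adj e.1 e.2) {a : ℤ × ℤ}
    (ha : l.head? = some a) : trace a (word l) = l := by
  induction l generalizing a with
  | nil => simp at ha
  | cons c t ih =>
    obtain rfl : c = a := by simpa using ha
    cases t with
    | nil => rfl
    | cons d t =>
      have hmv : move c (dir (c, d)) = d := move_dir (e := (c, d)) (hl (c, d) (by simp))
      rw [word_cons_cons, trace, hmv]
      rw [ih (fun e he => hl e (by simp [he])) rfl]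

/-- The set of edges crossed by the path from `a` with word `w`. -/
noncomputable def decode (a : ℤ × ℤ) (w : List Dir) : Finset (Sym2 (ℤ × ℤ)) :=
  open Classical in ((steps (trace a w)).map cross).toFinset

variable {x₁ x₂ : ℕ}

theorem exists_decode {γ : Finset (Sym2 (ℤ × ℤ))} (hγ : IsContour γ)
    (h : {((0 : ℤ), (0 : ℤ)), ((x₁ : ℤ), (x₂ : ℤ))} ⊆ vertexInterior γ) :
    ∃ (a : ℤ × ℤ) (w : List Dir), a.1 ≤ 0 ∧ a.2 ≤ 0 ∧ decode a w = γ ∧ w.length = γ.card ∧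
      minimalContourSize x₁ x₂ + 2 * (-a.1 - a.2) ≤ γ.card ∧
      (hullWord (x₁ + x₂ + 2) (hull (x₁, x₂) (vertexInterior γ))).Sublist w := by
  classical
  have hx : ((x₁ : ℤ), (x₂ : ℤ)) ∈ vertexInterior γ := h (by simp)
  obtain ⟨a, l, ha₁, ha₂, hhead, hadj, hmem, hnd, hlen, hsub⟩ :=
    (IsContour.isRegion hγ).exists_closed_path (h (Set.mem_insert _ _)) hx
  have hdec : decode a (word l) = γ := by
    ext f
    rw [decode, trace_word hadj hhead, List.mem_toFinset, ← hmem, ← coe_eq_edgeBoundary hγ,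
      Finset.mem_coe]
  have hcard : (word l).length = γ.card := by
    rw [← hdec, decode, trace_word hadj hhead, List.toFinset_card_of_nodup (by convert hnd)]
    simp [word]
  exact ⟨a, word l, ha₁, ha₂, hdec, hcard, hcard ▸ hlen, hsub⟩

/-- The hull boundary has at most ‖x‖ edges by the row and column count, and at least ‖x‖ by
`exists_decode` applied to `δ` itself. -/
theorem exists_minimal_contour {γ : Finset (Sym2 (ℤ × ℤ))} (hγ : IsContour γ)
    (h : {((0 : ℤ), (0 : ℤ)), ((x₁ : ℤ), (x₂ : ℤ))} ⊆ vertexInterior γ) :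
    ∃ δ ∈ contoursAround x₁ x₂ (minimalContourSize x₁ x₂),
      vertexInterior δ = hull (x₁, x₂) (vertexInterior γ) := by
  have h0 := h (Set.mem_insert _ _)
  have hx : ((x₁ : ℤ), (x₂ : ℤ)) ∈ vertexInterior γ := h (by simp)
  have hI := (IsContour.isRegion hγ).isRegion_hull h0 hx
  obtain ⟨δ, hδ, hcard⟩ := exists_finset_hull (x₁ := x₁) (x₂ := x₂) (vertexInterior γ)
  have h0' : (0, 0) ∈ hull (x₁, x₂) (vertexInterior γ) :=
    zero_mem_hull h0 (by simp) (by simp)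
  have hx' := mem_hull_self hx (by simp) (by simp)
  have hint := hI.vertexInterior_eq hδ
  have hδc := hI.isContour ⟨_, h0'⟩ hδ
  have hsub : {((0 : ℤ), (0 : ℤ)), ((x₁ : ℤ), (x₂ : ℤ))} ⊆ vertexInterior δ := by
    rw [hint]
    rintro v (rfl | rfl)
    · exact h0'
    · exact hx'
  obtain ⟨a, w, ha₁, ha₂, -, -, hle, -⟩ := exists_decode hδc hsub
  exact ⟨δ, ⟨hδc, hsub, by omega⟩, hint⟩

/-- The points `(-i, -j)` with `i + j ≤ k`. -/
def startPoints (k : ℕ) : Finset (ℤ × ℤ) :=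
  (Finset.range (k + 1)).biUnion fun j =>
    (Finset.HasAntidiagonal.antidiagonal j).image fun p => (-(p.1 : ℤ), -(p.2 : ℤ))

theorem mem_startPoints {k : ℕ} {a : ℤ × ℤ} (h1 : a.1 ≤ 0) (h2 : a.2 ≤ 0)
    (h : -a.1 - a.2 ≤ k) : a ∈ startPoints k := by
  obtain ⟨i, hi⟩ := Int.eq_ofNat_of_zero_le (a := -a.1) (by omega)
  obtain ⟨j, hj⟩ := Int.eq_ofNat_of_zero_le (a := -a.2) (by omega)
  refine Finset.mem_biUnion.2 ⟨i + j, Finset.mem_range.2 (by omega),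
    Finset.mem_image.2 ⟨(i, j), by simp, ?_⟩⟩
  ext <;> simp only <;> omega

theorem card_startPoints_le (k : ℕ) :
    (startPoints k).card ≤ ∑ j ∈ Finset.range (k + 1), (j + 1) := by
  refine Finset.card_biUnion_le.trans (Finset.sum_le_sum fun j _ => ?_)
  exact Finset.card_image_le.trans (by simp)

theorem finite_contoursAround (x₁ x₂ n : ℕ) : (contoursAround x₁ x₂ n).Finite := by
  classical
  refine ((startPoints n).biUnion fun a =>
    (superwords [] n).image (decode a)).finite_toSet.subset ?_
  rintro γ ⟨hγ, hsub, hcard⟩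
  obtain ⟨a, w, ha₁, ha₂, hdec, hlen, hle, -⟩ := exists_decode hγ hsub
  rw [Finset.mem_coe, Finset.mem_biUnion]
  refine ⟨a, mem_startPoints ha₁ ha₂ (by omega), Finset.mem_image.2 ⟨w, ?_, hdec⟩⟩
  rw [← hcard, ← hlen]
  exact mem_superwords (List.nil_sublist w)

/-- A contour is encoded by its minimal contour, its starting point and its word. The bound m / 2
for the starting point reflects that its displacement is paid for twice. -/
theorem ncard_contoursAround_le (x₁ x₂ m : ℕ) :
    (contoursAround x₁ x₂ (minimalContourSize x₁ x₂ + m)).ncard ≤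
      minimalContourCount x₁ x₂ * ((∑ j ∈ Finset.range (m / 2 + 1), (j + 1)) *
        ∑ i ∈ Finset.range (m + 1), (minimalContourSize x₁ x₂ + m).choose i * 3 ^ i) := by
  classical
  have hfin := finite_contoursAround x₁ x₂ (minimalContourSize x₁ x₂)
  set N := minimalContourSize x₁ x₂ with hN
  have hNw : ∀ Q, (hullWord (x₁ + x₂ + 2) Q).length = N := fun Q => length_hullWord _ Q
  let F : Finset (Finset (Sym2 (ℤ × ℤ))) := hfin.toFinset.biUnion fun δ =>
    (startPoints (m / 2)).biUnion fun a =>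
      (superwords (hullWord (x₁ + x₂ + 2) (vertexInterior δ)) (N + m)).image (decode a)
  have hF : contoursAround x₁ x₂ (N + m) ⊆ F := by
    rintro γ ⟨hγ, hsub, hcard⟩
    obtain ⟨a, w, ha₁, ha₂, hdec, hlen, hle, hw⟩ := exists_decode hγ hsub
    obtain ⟨δ, hδ, hint⟩ := exists_minimal_contour hγ hsub
    simp only [F, Finset.mem_coe, Finset.mem_biUnion, Finset.mem_image]
    refine ⟨δ, hfin.mem_toFinset.2 hδ, a, mem_startPoints ha₁ ha₂ ?_, w, ?_, hdec⟩
    · rw [hcard, ← hN] at hle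
      push_cast at hle ⊢
      omega
    · rw [hint, ← hcard, ← hlen]
      exact mem_superwords hw
  refine (Set.ncard_le_ncard hF F.finite_toSet).trans ?_
  rw [Set.ncard_coe_finset, minimalContourCount, ← hN, Set.ncard_eq_toFinset_card _ hfin]
  refine Finset.card_biUnion_le_card_mul _ _ _ fun δ _ => ?_
  refine (Finset.card_biUnion_le_card_mul _ _ _ fun a _ => ?_).trans
    (Nat.mul_le_mul_right _ (card_startPoints_le _))
  refine Finset.card_image_le.trans ?_
  refine (card_superwords_le (c := 3) (by simp) _ _).trans ?_
  rw [hNw, show N + m + 1 - N = m + 1 by omega]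

end LatticeContour

theorem mainTheorem3 (x₁ x₂ : ℕ) (hx₁ : 0 < x₁) (hx₂ : 0 < x₂) (m : ℕ)
    (hm : 2 * m ≤ minimalContourSize x₁ x₂) :
    (contoursAround x₁ x₂ (minimalContourSize x₁ x₂)).Finite ∧
    (contoursAround x₁ x₂ (minimalContourSize x₁ x₂ + m)).Finite ∧
    (contoursAround x₁ x₂ (minimalContourSize x₁ x₂ + m)).ncard ≤
      12 ^ m * (minimalContourSize x₁ x₂).choose m * minimalContourCount x₁ x₂ := by
  refine ⟨LatticeContour.finite_contoursAround _ _ _, LatticeContour.finite_contoursAround _ _ _, ?_⟩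
  -- For m = 0 both sides equal β_x; the estimates behind `count_le` need m ≥ 1.
  rcases Nat.eq_zero_or_pos m with rfl | hpos
  · simp [minimalContourCount]
  · rw [mul_comm (12 ^ m * _)]
    exact (LatticeContour.ncard_contoursAround_le x₁ x₂ m).trans
      (Nat.mul_le_mul_left _ (LatticeContour.count_le hpos hm))
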